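/- **Setting.** The plane is $\mathbb R^2=\mathbb C$. A *loop of finite elastic energy* is a closed curve $\gamma:\mathbb R\to\mathbb R^2$, $L$-periodic ($L>0$) and parametrized by arc length, $\gamma'(s)=(\cos\theta(s),\sin\theta(s))$, whose tangent angle $\theta$ is of class $H^1$ on bounded intervals. Its curvature is $k=\theta'$ and its elastic energy is $E(\gamma)=\frac12\int_0^L k(s)^2\,ds<\infty$. A *loop domain* is a pair $(\Omega,\gamma)$ in which $\gamma$ is a loop of finite elastic energy that may touch itself but does not cross itself (it is a $C^1$ limit of simple closed curves of period $L$), and $\Omega$ is a bounded open set, disjoint from the curve and with $\partial\Omega\subseteq\gamma(\mathbb R)$, such that every closed path in $\Omega$ is contractible in $\Omega$ and $\gamma$ has winding number $1$ around every point of $\Omega$ and $0$ around every other point off the curve. It is a *Jordan domain* if moreover $\gamma$ is simple, $\Omega$ is (connected and) simply connected and $\partial\Omega=\gamma(\mathbb R)$. Write $E(\partial\Omega)=E(\gamma)$, and $A(\Omega)$ for the area of $\Omega$. A *free branch* of $\gamma$ is a piece $\gamma|_{(a,b)}$, $a<b$, containing no self-intersection point: if $s\in(a,b)$, $t\in\mathbb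 R$ and $\gamma(t)=\gamma(s)$, then $t-s\in L\mathbb Z$. **Theorem (Optimality conditions).** Let $(\Omega,\gamma)$ minimize $E(\partial\Omega)+A(\Omega)$ either among all Jordan domains or among all loop domains, and let $\gamma|_{(a,b)}$ be a free branch. Then $k$ is $C^\infty$ on $(a,b)$ and $$k''=-\tfrac12k^3+1\quad\text{on }(a,b).$$ Moreover there are a constant $C\in\mathbb R$ and a point $Q\in\mathbb R^2$ such that, for every $s\in(a,b)$, with $M=\gamma(s)$ and $\nu=(\sin\theta(s),-\cos\theta(s))$ the outward unit normal at $M$, $$k'(s)^2=-\tfrac14k(s)^4+2k(s)+2C,\qquad |QM|^2=2k(s)+2C,\qquad \overrightarrow{QM}\cdot\nu=\tfrac12k(s)^2 .$$ -/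

import Mathlib

open Set MeasureTheory Metric
open scoped ContDiff

/-- A closed plane curve of finite elastic energy, parametrized by arc length. The plane is `ℂ`.
`L` is the length, `γ` the `L`-periodic arc-length parametrization, and `θ` the angle of the tangent
with the real axis, which is of class `H¹`: it is absolutely continuous on bounded intervals and its
derivative, the curvature, is square integrable over a period. -/
structure ElasticLoop where
  L : ℝ
  L_pos : 0 < L
  γ : ℝ → ℂ
  θ : ℝ → ℝ
  periodic : Function.Periodic γ L
  hasDerivAt : ∀ s, HasDerivAt γ (Complex.exp (θ s * Complex.I)) s
  absolutelyContinuous : ∀ a b, AbsolutelyContinuousOnInterval θ a b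
  memLp : MemLp (deriv θ) 2 (volume.restrict (Icc 0 L))

/-- `η : ℝ → ℂ`, seen as a loop of period `L`, takes the same value at two parameters only when
they differ by a multiple of the period. -/
def IsSimpleLoop (L : ℝ) (η : ℝ → ℂ) : Prop :=
  ∀ s t, η s = η t → ∃ n : ℤ, t = s + n * L

namespace ElasticLoop

/-- The curvature `k = θ'`. -/
noncomputable def curvature (c : ElasticLoop) : ℝ → ℝ := deriv c.θ

/-- The elastic energy `E = ½ ∫ k²`. -/
noncomputable def elasticEnergy (c : ElasticLoop) : ℝ :=
  (1 / 2) * ∫ s in (0 : ℝ)..c.L, c.curvature s ^ 2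

/-- The unit tangent vector. -/
noncomputable def tangent (c : ElasticLoop) (s : ℝ) : ℂ := Complex.exp (c.θ s * Complex.I)

/-- The unit normal vector obtained by rotating the tangent by `-π / 2`: the outward one when the
loop is the positively oriented boundary of a domain. -/
noncomputable def normal (c : ElasticLoop) (s : ℝ) : ℂ := -Complex.I * c.tangent s

/-- The winding number of the loop around a point `z` that does not lie on it. -/
noncomputable def windingNumber (c : ElasticLoop) (z : ℂ) : ℂ :=
  (2 * Real.pi * Complex.I)⁻¹ * ∫ s in (0 : ℝ)..c.L, c.tangent s / (c.γ s - z)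

/-- The loop is a `C¹` limit of simple loops: it may touch itself, but it does not cross itself. -/
def IsLimitOfSimpleLoops (c : ElasticLoop) : Prop :=
  ∀ ε > 0, ∃ η : ℝ → ℂ, ContDiff ℝ 1 η ∧ Function.Periodic η c.L ∧ IsSimpleLoop c.L η ∧
    ∀ s, ‖c.γ s - η s‖ < ε ∧ ‖c.tangent s - deriv η s‖ < ε

/-- A free branch of the loop: no point `γ s` with `a < s < b` is a self-intersection point. -/
def IsFreeBranch (c : ElasticLoop) (a b : ℝ) : Prop :=
  a < b ∧ ∀ s ∈ Ioo a b, ∀ t, c.γ s = c.γ t → ∃ n : ℤ, t = s + n * c.L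

end ElasticLoop

/-- `Ω` is a bounded open set, in which every closed path is contractible, and it is bounded by the
positively oriented loop `c`, which may touch itself but does not cross itself. -/
structure IsLoopDomain (Ω : Set ℂ) (c : ElasticLoop) : Prop where
  isOpen : IsOpen Ω
  isBounded : Bornology.IsBounded Ω
  contractible : ∀ (x : Ω) (p : Path x x), p.Homotopic (Path.refl x)
  limit : c.IsLimitOfSimpleLoops
  disjoint : Disjoint Ω (range c.γ)
  frontier_subset : frontier Ω ⊆ range c.γ
  winding_inside : ∀ z ∈ Ω, c.windingNumber z = 1
  winding_outside : ∀ z, z ∉ Ω → z ∉ range c.γ → c.windingNumber z = 0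

/-- `Ω` is a bounded simply connected open set whose boundary is the positively oriented simple
loop `c`. -/
structure IsJordanDomain (Ω : Set ℂ) (c : ElasticLoop) : Prop extends IsLoopDomain Ω c where
  simplyConnected : IsSimplyConnected Ω
  simple : IsSimpleLoop c.L c.γ
  frontier_eq : frontier Ω = range c.γ

/-- The functional `E(∂Ω) + A(Ω)`. -/
noncomputable def totalEnergy (Ω : Set ℂ) (c : ElasticLoop) : ℝ :=
  c.elasticEnergy + volume.real Ω

/-- `(Ω, c)` belongs to the class `𝒜` and minimizes `E(∂Ω) + A(Ω)` in it. -/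
def IsEnergyMinimizer (𝒜 : Set ℂ → ElasticLoop → Prop) (Ω : Set ℂ) (c : ElasticLoop) : Prop :=
  𝒜 Ω c ∧ ∀ Ω' c', 𝒜 Ω' c' → totalEnergy Ω c ≤ totalEnergy Ω' c'

/-!
Let `(Ω, γ)` be a minimizer. The competitors are the images of `(Ω, γ)` under the maps
`z ↦ z + t X z`, where `X` is a compactly supported vector field of class `C¹` on the plane and `t`
is small. Such a map is a homeomorphism of the plane, so it preserves both classes of domains
(`IsPerturbation.isLoopDomain`, `IsPerturbation.isJordanDomain`); winding numbers are preserved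
because `(γ + t X ∘ γ - (z + t X z)) / (γ - z)` stays in the right half-plane and has a logarithm.
The field need not be smooth: it is enough that `X ∘ γ` be of class `C²`, since the tangent angle of
the image is that of `γ` plus the argument of a function built from the derivative of `X ∘ γ`
(`exists_isPerturbation`).

The area is computed from the curve: the indicator of `Ω` is the winding number, and integrating the
Cauchy kernel over a large disc first gives `A(Ω) = ½ ∫ ⟨γ, ν⟩` (`IsLoopDomain.volume_real_eq`). The
first variation along `v = X ∘ γ` is then an explicit linear functional of `v, v', v''`, which
vanishes by minimality (`integral_variationDensity_eq_zero`).

Near a point `γ s₀` of a free branch no other strand of the curve passes, and the curve is a `C¹`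
graph over its tangent. Hence every smooth `v` supported near `s₀` is of the form `X ∘ γ`
(`exists_ambient_field`), and the curvature satisfies the weak Euler equation
`(k iτ)'' + (3/2 k² τ)' - iτ = 0` near `s₀`. Two applications of the du Bois-Reymond lemma show that
`k` is continuous, then differentiable, and that `k' τ + ½ k² ν - γ` is locally constant
(`exists_curvature_deriv_eq`). On the whole branch this vector is a constant `-Q`. The tangential
part of `k' τ + ½ k² ν = γ - Q` differentiates to `k'' = -½ k³ + 1`, the normal part is the formula
for `QM · ν`, and the first integral `k'² + ¼ k⁴ - 2 k = 2 C` of the differential equation gives the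
two remaining identities.
-/

/-! ### Calculus on the line -/

/-- A continuously differentiable function on the line whose derivative is bounded below by a
positive constant has a continuously differentiable global inverse. -/
theorem exists_inverse_of_deriv_ge {S q : ℝ → ℝ} {m : ℝ} (hm : 0 < m) (hq : ∀ s, m ≤ q s)
    (hS : ∀ s, HasDerivAt S (q s) s) :
    ∃ σ : ℝ → ℝ, (∀ s, σ (S s) = s) ∧ (∀ y, S (σ y) = y) ∧ StrictMono S ∧ StrictMono σ ∧
      ∀ y, HasDerivAt σ (q (σ y))⁻¹ y := by
  have hmono : StrictMono S := strictMono_of_hasDerivAt_pos hS fun s => hm.trans_le (hq s)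
  have hcont : Continuous S := continuous_iff_continuousAt.2 fun s => (hS s).continuousAt
  have hgrow : Monotone fun s => S s - m * s := by
    refine monotone_of_hasDerivAt_nonneg (f' := fun s => q s - m * 1) (fun s => ?_) fun s => ?_
    · exact (hS s).sub ((hasDerivAt_id s).const_mul m)
    · simpa using hq s
  have htop : Filter.Tendsto S Filter.atTop Filter.atTop := by
    refine Filter.tendsto_atTop_mono' _ (f₁ := fun s => m * s + S 0) ?_
      (Filter.tendsto_atTop_add_const_right _ _ (Filter.tendsto_id.const_mul_atTop hm))
    filter_upwards [Filter.eventually_ge_atTop 0] with s hs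
    have := hgrow hs
    simp only [mul_zero, sub_zero] at this
    linarith
  have hbot : Filter.Tendsto S Filter.atBot Filter.atBot := by
    refine Filter.tendsto_atBot_mono' _ (f₁ := fun s => m * s + S 0) ?_
      (Filter.tendsto_atBot_add_const_right _ _ (Filter.tendsto_id.const_mul_atBot hm))
    filter_upwards [Filter.eventually_le_atBot 0] with s hs
    have := hgrow hs
    simp only [mul_zero, sub_zero] at this
    linarith
  have hsurj : Function.Surjective S := hcont.surjective htop hbot
  let e : ℝ ≃o ℝ := StrictMono.orderIsoOfSurjective S hmono hsurj
  refine ⟨e.symm, fun s => e.symm_apply_apply s, fun y => e.apply_symm_apply y, hmono,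
    e.symm.strictMono, fun y => ?_⟩
  refine HasDerivAt.of_local_left_inverse (f := S) e.symm.continuous.continuousAt (hS _)
    (hm.trans_le (hq _)).ne' (Filter.Eventually.of_forall fun z => e.apply_symm_apply z)

/-- Absolute continuity is preserved by an increasing Lipschitz change of parameter. -/
theorem AbsolutelyContinuousOnInterval.comp_strictMono {F : Type*} [PseudoMetricSpace F]
    {f : ℝ → F} {σ : ℝ → ℝ} {K : NNReal} (hσ : StrictMono σ) (hL : LipschitzWith K σ)
    {a b : ℝ} (hf : AbsolutelyContinuousOnInterval f (σ a) (σ b)) :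
    AbsolutelyContinuousOnInterval (f ∘ σ) a b := by
  rw [absolutelyContinuousOnInterval_iff] at hf ⊢
  intro ε hε
  obtain ⟨δ, hδ, h⟩ := hf ε hε
  refine ⟨δ / (K + 1), by positivity, fun E hE hlen => ?_⟩
  refine h (E.1, fun i => (σ (E.2 i).1, σ (E.2 i).2)) ⟨fun i hi => ?_, ?_⟩ ?_
  · exact ⟨hσ.monotone.image_uIcc_subset (mem_image_of_mem _ (hE.1 i hi).1),
      hσ.monotone.image_uIcc_subset (mem_image_of_mem _ (hE.1 i hi).2)⟩
  · intro i hi j hj hij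
    have := hE.2 hi hj hij
    simp only [Function.onFun, uIoc, ← hσ.monotone.map_min, ← hσ.monotone.map_max] at this ⊢
    rw [Set.Ioc_disjoint_Ioc, ← hσ.monotone.map_min, ← hσ.monotone.map_max] at *
    exact hσ.monotone this
  · calc ∑ i ∈ Finset.range E.1, dist (σ (E.2 i).1) (σ (E.2 i).2)
        ≤ ∑ i ∈ Finset.range E.1, (K + 1) * dist (E.2 i).1 (E.2 i).2 := by
          refine Finset.sum_le_sum fun i _ => (hL.dist_le_mul _ _).trans ?_
          gcongr
          linarith
      _ < δ := by
          rw [← Finset.mul_sum, mul_comm]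
          exact (lt_div_iff₀ (by positivity)).1 hlen

/-- Absolute continuity is preserved by composition with a map that is Lipschitz on the range. -/
theorem AbsolutelyContinuousOnInterval.lipschitzOnWith_comp {X Y : Type*} [PseudoMetricSpace X]
    [PseudoMetricSpace Y] {f : ℝ → X} {g : X → Y} {K : NNReal} {t : Set X}
    (hg : LipschitzOnWith K g t) {a b : ℝ} (hf : AbsolutelyContinuousOnInterval f a b)
    (hft : ∀ x, f x ∈ t) : AbsolutelyContinuousOnInterval (g ∘ f) a b := by
  rw [absolutelyContinuousOnInterval_iff] at hf ⊢
  intro ε hε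
  obtain ⟨δ, hδ, h⟩ := hf (ε / (K + 1)) (by positivity)
  refine ⟨δ, hδ, fun E hE hlen => ?_⟩
  calc ∑ i ∈ Finset.range E.1, dist (g (f (E.2 i).1)) (g (f (E.2 i).2))
      ≤ ∑ i ∈ Finset.range E.1, (K + 1) * dist (f (E.2 i).1) (f (E.2 i).2) := by
        refine Finset.sum_le_sum fun i _ => (hg.dist_le_mul _ (hft _) _ (hft _)).trans ?_
        gcongr
        linarith
    _ < ε := by
        rw [← Finset.mul_sum, mul_comm]
        exact (lt_div_iff₀ (by positivity)).1 (h E hE hlen)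

theorem AbsolutelyContinuousOnInterval.ae_hasDerivAt {f : ℝ → ℝ}
    (hf : ∀ a b, AbsolutelyContinuousOnInterval f a b) : ∀ᵐ s, HasDerivAt f (deriv f s) s := by
  have h : ∀ n : ℕ, ∀ᵐ s, s ∈ uIcc (-(n : ℝ)) n → DifferentiableAt ℝ f s := fun n =>
    (hf _ _).boundedVariationOn.ae_differentiableAt_of_mem_uIcc
  filter_upwards [ae_all_iff.2 h] with s hs
  obtain ⟨n, hn⟩ := exists_nat_ge |s|
  exact (hs n (by rw [mem_uIcc]; exact Or.inl (abs_le.1 hn))).hasDerivAt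

/-! ### Elastic loops -/

namespace ElasticLoop

variable (c : ElasticLoop)

theorem continuous_γ : Continuous c.γ :=
  continuous_iff_continuousAt.2 fun s => (c.hasDerivAt s).continuousAt

theorem continuous_θ : Continuous c.θ := by
  refine continuous_iff_continuousAt.2 fun s => ?_
  refine (c.absolutelyContinuous (s - 1) (s + 1)).continuousOn.continuousAt ?_
  rw [uIcc_of_le (by linarith)]
  exact Icc_mem_nhds (by linarith) (by linarith)

theorem continuous_tangent : Continuous c.tangent := by
  have := c.continuous_θ
  unfold tangent
  fun_prop

theorem norm_tangent (s : ℝ) : ‖c.tangent s‖ = 1 := Complex.norm_exp_ofReal_mul_I _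

theorem hasDerivAt_γ (s : ℝ) : HasDerivAt c.γ (c.tangent s) s := c.hasDerivAt s

theorem deriv_γ : deriv c.γ = c.tangent := funext fun s => (c.hasDerivAt s).deriv

theorem periodic_tangent : Function.Periodic c.tangent c.L := by
  intro s
  have h := (c.hasDerivAt_γ (s + c.L)).comp_add_const s c.L
  rw [show (fun x => c.γ (x + c.L)) = c.γ from funext c.periodic] at h
  exact h.unique (c.hasDerivAt_γ s)

theorem conj_tangent_mul (s : ℝ) : (starRingEnd ℂ) (c.tangent s) * c.tangent s = 1 := by
  rw [mul_comm, Complex.mul_conj, Complex.normSq_eq_norm_sq, norm_tangent]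
  simp

theorem conj_tangent (s : ℝ) :
    (starRingEnd ℂ) (c.tangent s) = Complex.exp (-(c.θ s * Complex.I)) := by
  rw [tangent, ← Complex.exp_conj]
  simp

/-- The tangent angle increases by the same multiple of `2π` along every period. -/
theorem exists_θ_add (c : ElasticLoop) : ∃ d : ℝ, ∀ s, c.θ (s + c.L) = c.θ s + d := by
  have h : ∀ s, ∃ n : ℤ, c.θ (s + c.L) = c.θ s + n * (2 * Real.pi) := by
    intro s
    obtain ⟨n, hn⟩ := Complex.exp_eq_exp_iff_exists_int.1 (c.periodic_tangent s)
    refine ⟨n, ?_⟩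
    have h2 := congrArg Complex.im hn
    simpa using h2
  choose n hn using h
  have hcont : Continuous fun s => (n s : ℝ) := by
    have : (fun s => (n s : ℝ)) = fun s => (c.θ (s + c.L) - c.θ s) / (2 * Real.pi) := by
      ext s
      rw [hn s]
      field_simp
      ring
    rw [this]
    have := c.continuous_θ
    fun_prop
  have hn' : Continuous n := Int.isClosedEmbedding_coe_real.isInducing.continuous_iff.2 hcont
  refine ⟨n 0 * (2 * Real.pi), fun s => ?_⟩
  rw [hn s, PreconnectedSpace.constant inferInstance hn' (x := s) (y := 0)]

theorem periodic_curvature : Function.Periodic c.curvature c.L := by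
  obtain ⟨d, hd⟩ := c.exists_θ_add
  intro s
  have h : (fun x => c.θ (x + c.L)) = fun x => c.θ x + d := funext hd
  have h2 : deriv (fun x => c.θ (x + c.L)) s = deriv (fun x => c.θ x + d) s := by rw [h]
  rwa [deriv_comp_add_const, deriv_add_const] at h2

theorem ae_hasDerivAt_θ : ∀ᵐ s, HasDerivAt c.θ (c.curvature s) s :=
  AbsolutelyContinuousOnInterval.ae_hasDerivAt c.absolutelyContinuous

theorem measurable_curvature : Measurable c.curvature := measurable_deriv _

theorem intervalIntegrable_curvature (a b : ℝ) : IntervalIntegrable c.curvature volume a b :=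
  (c.absolutelyContinuous a b).intervalIntegrable_deriv

theorem intervalIntegrable_curvature_sq (a b : ℝ) :
    IntervalIntegrable (fun s => c.curvature s ^ 2) volume a b := by
  have h : IntervalIntegrable (fun s => c.curvature s ^ 2) volume 0 (0 + c.L) := by
    rw [zero_add, intervalIntegrable_iff_integrableOn_Icc_of_le c.L_pos.le]
    exact c.memLp.integrable_sq
  have hp : Function.Periodic (fun s => c.curvature s ^ 2) c.L := fun s => by
    simp only [c.periodic_curvature s]
  exact hp.intervalIntegrable c.L_pos.ne' h a b

theorem θ_sub_eq (a b : ℝ) : c.θ b - c.θ a = ∫ s in a..b, c.curvature s :=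
  (c.absolutelyContinuous a b).integral_deriv_eq_sub.symm

end ElasticLoop

/-! ### The Cauchy transform of a disc -/

theorem circleIntegral_inv_mul_inv_sub {ζ : ℂ} {ρ : ℝ} (hρ : 0 < ρ) (hne : ρ ≠ ‖ζ‖) :
    (∮ z in C(0, ρ), (Complex.I * z)⁻¹ * (ζ - z)⁻¹) = if ρ < ‖ζ‖ then 2 * Real.pi / ζ else 0 := by
  by_cases h0 : ζ = 0
  · subst h0
    have h : ∀ z : ℂ, (Complex.I * z)⁻¹ * (0 - z)⁻¹ = Complex.I * (z - 0) ^ (-2 : ℤ) := by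
      intro z
      rw [zpow_neg, zpow_ofNat, mul_inv, zero_sub, inv_neg, Complex.inv_I, sub_zero, sq, mul_inv]
      ring
    simp_rw [h]
    rw [circleIntegral.integral_const_mul, circleIntegral.integral_sub_zpow_of_ne (by decide)]
    simp
  · have hmem : ∀ z ∈ sphere (0 : ℂ) ρ, z ≠ 0 ∧ z - ζ ≠ 0 := by
      intro z hz
      rw [mem_sphere_zero_iff_norm] at hz
      refine ⟨fun h => hρ.ne' (by rw [← hz, h, norm_zero]), fun h => hne ?_⟩
      rw [← hz, sub_eq_zero.1 h]
    have h : EqOn (fun z : ℂ => (Complex.I * z)⁻¹ * (ζ - z)⁻¹)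
        (fun z => (Complex.I * ζ)⁻¹ * ((z - 0)⁻¹ - (z - ζ)⁻¹)) (sphere 0 ρ) := by
      intro z hz
      obtain ⟨h1, h2⟩ := hmem z hz
      have h3 : ζ - z ≠ 0 := by rwa [← neg_sub, neg_ne_zero]
      have h4 := Complex.I_ne_zero
      simp only [sub_zero]
      field_simp
      ring
    have hc1 : CircleIntegrable (fun z : ℂ => (z - 0)⁻¹) 0 ρ := by
      refine ContinuousOn.circleIntegrable hρ.le fun z hz => ?_
      exact (ContinuousAt.inv₀ (by fun_prop) (by simpa using (hmem z hz).1)).continuousWithinAt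
    have hc2 : CircleIntegrable (fun z : ℂ => (z - ζ)⁻¹) 0 ρ := by
      refine ContinuousOn.circleIntegrable hρ.le fun z hz => ?_
      have hcz : ContinuousAt (fun w : ℂ => w - ζ) z := by fun_prop
      exact (hcz.inv₀ (hmem z hz).2).continuousWithinAt
    rw [circleIntegral.integral_congr hρ.le h, circleIntegral.integral_const_mul,
      circleIntegral.integral_sub hc1 hc2, circleIntegral.integral_sub_center_inv _ hρ.ne']
    split_ifs with hlt
    · have : (∮ z in C(0, ρ), (z - ζ)⁻¹) = 0 := by
        have hd : ∀ z ∈ closedBall (0 : ℂ) ρ, z - ζ ≠ 0 := by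
          intro z hz h
          rw [mem_closedBall_zero_iff, sub_eq_zero.1 h] at hz
          exact absurd hlt (not_lt.2 hz)
        refine Complex.circleIntegral_eq_zero_of_differentiable_on_off_countable hρ.le
          countable_empty (fun z hz => ?_) fun z hz => ?_
        · have hcz : ContinuousAt (fun w : ℂ => w - ζ) z := by fun_prop
          exact (hcz.inv₀ (hd z hz)).continuousWithinAt
        · exact DifferentiableAt.inv (by fun_prop) (hd z (ball_subset_closedBall hz.1))
      rw [this]
      have h4 := Complex.I_ne_zero
      field_simp
      ring
    · rw [circleIntegral.integral_sub_inv_of_mem_ball, sub_self, mul_zero]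
      rw [mem_ball_zero_iff]
      exact lt_of_le_of_ne (not_lt.1 hlt) (Ne.symm hne)

/-- The integral over all rotations of `z ↦ (ζ - z)⁻¹`. -/
theorem integral_rotation_inv_sub {ζ z : ℂ} (hz : z ≠ 0) (hne : ‖z‖ ≠ ‖ζ‖) :
    ∫ φ in (0 : ℝ)..2 * Real.pi, (ζ - Complex.exp (φ * Complex.I) * z)⁻¹ =
      if ‖z‖ < ‖ζ‖ then 2 * Real.pi / ζ else 0 := by
  have hz' := norm_pos_iff.2 hz
  have hrot : ∀ φ : ℝ, Complex.exp (φ * Complex.I) * z = circleMap 0 ‖z‖ (φ + z.arg) := by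
    intro φ
    conv_lhs => rw [← Complex.norm_mul_exp_arg_mul_I z]
    rw [circleMap]
    push_cast
    rw [add_mul, Complex.exp_add]
    ring
  have hper : Function.Periodic (fun φ : ℝ => (ζ - circleMap 0 ‖z‖ φ)⁻¹) (2 * Real.pi) :=
    fun φ => by simp only [periodic_circleMap 0 ‖z‖ φ]
  simp_rw [hrot]
  rw [intervalIntegral.integral_comp_add_right (fun φ => (ζ - circleMap 0 ‖z‖ φ)⁻¹),
    zero_add, add_comm (2 * Real.pi), hper.intervalIntegral_add_eq z.arg 0, zero_add,
    ← circleIntegral_inv_mul_inv_sub hz' hne, circleIntegral]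
  refine intervalIntegral.integral_congr fun φ _ => ?_
  have h1 : circleMap 0 ‖z‖ φ ≠ 0 := circleMap_ne_center hz'.ne'
  have h4 := Complex.I_ne_zero
  simp only [deriv_circleMap, smul_eq_mul]
  rw [← mul_assoc, mul_comm Complex.I, mul_inv_cancel₀ (mul_ne_zero h1 h4), one_mul]

theorem integrable_indicator_inv_norm (r : ℝ) :
    Integrable (indicator (ball (0 : ℂ) r) fun z => ‖z‖⁻¹) := by
  rw [integrable_indicator_iff measurableSet_ball,
    integrableOn_fun_norm_addHaar volume (f := fun y : ℝ => y⁻¹), Complex.finrank_real_complex]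
  have h : IntegrableOn (fun _ : ℝ => (1 : ℝ)) (Ioo 0 r) := by simp
  refine h.congr_fun (fun y hy => ?_) measurableSet_Ioo
  simp [hy.1.ne']

/-- The Cauchy kernel is integrable on the product of a bounded curve and a disc. -/
theorem integrable_cauchy_kernel {p u : ℝ → ℂ} (hp : Continuous p) (hu : Continuous u)
    (a b R : ℝ) :
    Integrable (fun x : ℝ × ℂ => u x.1 / (p x.1 - x.2))
      ((volume.restrict (Ioc a b)).prod (volume.restrict (ball 0 R))) := by
  obtain ⟨P, hP⟩ := isCompact_Icc.exists_bound_of_continuousOn (s := Icc a b) hp.continuousOn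
  obtain ⟨M, hM⟩ := isCompact_Icc.exists_bound_of_continuousOn (s := Icc a b) hu.continuousOn
  set F : ℂ → ℝ := indicator (ball (0 : ℂ) (P + R)) fun z => ‖z‖⁻¹ with hF
  have hFi : Integrable F := integrable_indicator_inv_norm _
  have hF0 : ∀ z, 0 ≤ F z := fun z => indicator_nonneg (fun z _ => inv_nonneg.2 (norm_nonneg z)) z
  have hbound : ∀ s ∈ Ioc a b, ∀ z ∈ ball (0 : ℂ) R, ‖u s / (p s - z)‖ ≤ M * F (p s - z) := by
    intro s hs z hz
    have hmem : p s - z ∈ ball (0 : ℂ) (P + R) := by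
      rw [mem_ball_zero_iff] at hz ⊢
      have := hP s (Ioc_subset_Icc_self hs)
      have := norm_sub_le (p s) z
      linarith
    rw [hF, indicator_of_mem hmem, norm_div, div_eq_mul_inv]
    gcongr
    exact hM s (Ioc_subset_Icc_self hs)
  have hmeas : Measurable fun x : ℝ × ℂ => u x.1 / (p x.1 - x.2) := by
    have := hp.measurable
    have := hu.measurable
    fun_prop
  have hint : ∀ s ∈ Ioc a b, Integrable (fun z => u s / (p s - z)) (volume.restrict (ball 0 R)) := by
    intro s hs
    refine Integrable.mono' (g := fun z => M * F (p s - z)) ?_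
      (hmeas.comp measurable_prodMk_left).aestronglyMeasurable ?_
    · exact ((hFi.comp_sub_left (p s)).const_mul M).restrict
    · exact ae_restrict_of_forall_mem measurableSet_ball (hbound s hs)
  rw [integrable_prod_iff hmeas.aestronglyMeasurable]
  refine ⟨ae_restrict_of_forall_mem measurableSet_Ioc hint, ?_⟩
  refine Integrable.mono' (g := fun _ => M * ∫ z, F z) (integrable_const _)
    hmeas.norm.aestronglyMeasurable.integral_prod_right' ?_
  refine ae_restrict_of_forall_mem measurableSet_Ioc fun s hs => ?_
  have hM0 : 0 ≤ M := (norm_nonneg _).trans (hM s (Ioc_subset_Icc_self hs))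
  rw [Real.norm_of_nonneg (integral_nonneg fun _ => norm_nonneg _)]
  calc ∫ z in ball 0 R, ‖u s / (p s - z)‖
      ≤ ∫ z in ball 0 R, M * F (p s - z) := by
        refine setIntegral_mono_on (hint s hs).norm
          ((hFi.comp_sub_left (p s)).const_mul M).restrict measurableSet_ball (hbound s hs)
    _ ≤ ∫ z, M * F (p s - z) := by
        refine setIntegral_le_integral ((hFi.comp_sub_left (p s)).const_mul M)
          (Filter.Eventually.of_forall fun z => mul_nonneg hM0 (hF0 _))
    _ = M * ∫ z, F z := by
        rw [integral_const_mul, integral_sub_left_eq_self F volume (p s)]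

/-- The Cauchy transform of a disc centred at the origin is `π ζ̄` at every point `ζ` of the disc.
Averaging over the rotations reduces it to an integral over circles. -/
theorem integral_ball_inv_sub {ζ : ℂ} {R : ℝ} (hζ : ‖ζ‖ < R) :
    ∫ z in ball (0 : ℂ) R, (ζ - z)⁻¹ = Real.pi * (starRingEnd ℂ) ζ := by
  set J := ∫ z in ball (0 : ℂ) R, (ζ - z)⁻¹ with hJ
  have hrot : ∀ φ : ℝ, ∫ z in ball (0 : ℂ) R, (ζ - Complex.exp (φ * Complex.I) * z)⁻¹ = J := by
    intro φ
    let e : ℂ ≃ₗᵢ[ℝ] ℂ := rotation (Circle.exp φ)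
    have he : ∀ z, e z = Complex.exp (φ * Complex.I) * z := fun z => by
      simp [e, Circle.coe_exp]
    have hpre : e ⁻¹' ball (0 : ℂ) R = ball 0 R := by
      ext z
      simp
    have := e.measurePreserving.setIntegral_preimage_emb e.toHomeomorph.measurableEmbedding
      (fun z => (ζ - z)⁻¹) (ball 0 R)
    rw [hpre] at this
    rw [hJ, ← this]
    simp_rw [he]
  have hker : ∀ (φ : ℝ) (z : ℂ), (ζ - Complex.exp (φ * Complex.I) * z)⁻¹ =
      Complex.exp (-(φ * Complex.I)) / (Complex.exp (-(φ * Complex.I)) * ζ - z) := by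
    intro φ z
    have hne : Complex.exp (φ * Complex.I) ≠ 0 := Complex.exp_ne_zero _
    have h2 : ζ - Complex.exp (φ * Complex.I) * z =
        Complex.exp (φ * Complex.I) * (Complex.exp (-(φ * Complex.I)) * ζ - z) := by
      rw [Complex.exp_neg]
      field_simp
    rw [h2, mul_inv, Complex.exp_neg, div_eq_mul_inv]
  have hswap : ∫ φ in Ioc 0 (2 * Real.pi), ∫ z in ball (0 : ℂ) R,
        (ζ - Complex.exp ((φ : ℝ) * Complex.I) * z)⁻¹ =
      ∫ z in ball (0 : ℂ) R, ∫ φ in Ioc 0 (2 * Real.pi),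
        (ζ - Complex.exp ((φ : ℝ) * Complex.I) * z)⁻¹ := by
    refine integral_integral_swap ?_
    refine (integrable_cauchy_kernel (p := fun φ : ℝ => Complex.exp (-(φ * Complex.I)) * ζ)
      (u := fun φ : ℝ => Complex.exp (-(φ * Complex.I))) (by fun_prop) (by fun_prop)
      0 (2 * Real.pi) R).congr (Filter.Eventually.of_forall fun x => ?_)
    simp only [Function.uncurry, hker]
  have hinner : ∫ z in ball (0 : ℂ) R, ∫ φ in Ioc 0 (2 * Real.pi),
        (ζ - Complex.exp ((φ : ℝ) * Complex.I) * z)⁻¹ =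
      ∫ z in ball (0 : ℂ) R, indicator (ball 0 ‖ζ‖) (fun _ => 2 * (Real.pi : ℂ) / ζ) z := by
    refine integral_congr_ae (ae_restrict_of_ae ?_)
    have h0 : ∀ᵐ z : ℂ, z ≠ 0 := by simp [ae_iff, measure_singleton]
    have h1 : ∀ᵐ z : ℂ, z ∉ sphere (0 : ℂ) ‖ζ‖ :=
      measure_eq_zero_iff_ae_notMem.1 (Measure.addHaar_sphere volume 0 ‖ζ‖)
    filter_upwards [h0, h1] with z hz hz'
    rw [mem_sphere_zero_iff_norm] at hz'
    rw [← intervalIntegral.integral_of_le (by positivity), integral_rotation_inv_sub hz hz']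
    simp [indicator]
  simp_rw [hrot] at hswap
  rw [hinner, setIntegral_indicator measurableSet_ball,
    inter_eq_right.2 (ball_subset_ball hζ.le), setIntegral_const, setIntegral_const,
    measureReal_def, measureReal_def, Complex.volume_ball, Real.volume_Ioc] at hswap
  have hpi : (Real.pi : ℂ) ≠ 0 := by exact_mod_cast Real.pi_ne_zero
  have hL : (ENNReal.ofReal (2 * Real.pi - 0)).toReal = 2 * Real.pi := by
    rw [sub_zero, ENNReal.toReal_ofReal (by positivity)]
  have hR : (ENNReal.ofReal ‖ζ‖ ^ 2 * (NNReal.pi : ENNReal)).toReal = ‖ζ‖ ^ 2 * Real.pi := by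
    simp
  rw [hL, hR] at hswap
  simp only [Complex.real_smul] at hswap
  push_cast at hswap
  by_cases h0 : ζ = 0
  · subst h0
    have : (2 * (Real.pi : ℂ)) * J = 0 := by simpa using hswap
    simpa [hpi] using this
  · have h2 : (‖ζ‖ : ℂ) ^ 2 = ζ * (starRingEnd ℂ) ζ := by
      rw [Complex.mul_conj, Complex.normSq_eq_norm_sq]
      push_cast
      rfl
    rw [h2] at hswap
    have h3 : (2 * (Real.pi : ℂ)) * J = (2 * Real.pi) * (Real.pi * (starRingEnd ℂ) ζ) := by
      rw [hswap]
      field_simp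
    exact mul_left_cancel₀ (mul_ne_zero two_ne_zero hpi) h3

/-! ### The area enclosed by a loop -/

namespace ElasticLoop

theorem volume_range_γ (c : ElasticLoop) : volume (range c.γ) = 0 := by
  let f' : ℂ → ℂ →L[ℝ] ℂ := fun z =>
    (ContinuousLinearMap.toSpanSingleton ℝ (c.tangent z.re)).comp Complex.reCLM
  have hd : ∀ z ∈ (univ : Set ℂ), HasFDerivWithinAt (fun z : ℂ => c.γ z.re) (f' z) univ z := by
    intro z _
    exact ((c.hasDerivAt_γ z.re).hasFDerivAt.comp z Complex.reCLM.hasFDerivAt).hasFDerivWithinAt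
  have hdet : ∀ z ∈ (univ : Set ℂ), (f' z).det = 0 := by
    intro z _
    by_contra h
    have hu : IsUnit (f' z : ℂ →ₗ[ℝ] ℂ).det := isUnit_iff_ne_zero.2 h
    have hinj := (LinearMap.isUnit_iff_isUnit_det _).2 hu
    have hinj2 : Function.Injective (f' z) :=
      ((Module.End.isUnit_iff _).1 hinj).1
    have h1 : f' z Complex.I = f' z 0 := by simp [f']
    exact Complex.I_ne_zero (hinj2 h1)
  have h := addHaar_image_eq_zero_of_det_fderivWithin_eq_zero volume hd hdet
  refine measure_mono_null ?_ h
  rintro _ ⟨s, rfl⟩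
  exact ⟨(s : ℂ), mem_univ _, by simp⟩

end ElasticLoop

/-- The area of a loop domain is the circulation of `½ (x dy - y dx)` along the loop: the indicator
of the domain is the winding number, an integral of the Cauchy kernel, which is integrated in the
other variable first. -/
theorem IsLoopDomain.volume_real_eq {Ω : Set ℂ} {c : ElasticLoop} (h : IsLoopDomain Ω c) :
    volume.real Ω = (1 / 2) * ∫ s in (0 : ℝ)..c.L, inner ℝ (c.γ s) (c.normal s) := by
  obtain ⟨R₁, hR₁⟩ := (h.isBounded.subset_ball 0)
  obtain ⟨P, hP⟩ := isCompact_Icc.exists_bound_of_continuousOn (s := Icc 0 c.L)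
    c.continuous_γ.continuousOn
  set R := max R₁ (P + 1)
  have hΩR : Ω ⊆ ball 0 R := hR₁.trans (ball_subset_ball (le_max_left _ _))
  have hγR : ∀ s ∈ Ioc 0 c.L, ‖c.γ s‖ < R := fun s hs =>
    (hP s (Ioc_subset_Icc_self hs)).trans_lt ((lt_add_one P).trans_le (le_max_right _ _))
  have hwind : ∫ z in ball (0 : ℂ) R, c.windingNumber z = (volume.real Ω : ℂ) := by
    have hae : ∀ᵐ z, z ∉ range c.γ := measure_eq_zero_iff_ae_notMem.1 c.volume_range_γ
    have : ∫ z in ball (0 : ℂ) R, c.windingNumber z =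
        ∫ z in ball (0 : ℂ) R, indicator Ω (fun _ => (1 : ℂ)) z := by
      refine integral_congr_ae (ae_restrict_of_ae ?_)
      filter_upwards [hae] with z hz
      by_cases hzΩ : z ∈ Ω
      · rw [h.winding_inside z hzΩ, indicator_of_mem hzΩ]
      · rw [h.winding_outside z hzΩ hz, indicator_of_notMem hzΩ]
    rw [this, setIntegral_indicator h.isOpen.measurableSet, inter_eq_right.2 hΩR,
      setIntegral_const]
    simp
  have hswap : ∫ z in ball (0 : ℂ) R, ∫ s in Ioc 0 c.L, c.tangent s / (c.γ s - z) =
      ∫ s in Ioc 0 c.L, ∫ z in ball (0 : ℂ) R, c.tangent s / (c.γ s - z) :=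
    (integral_integral_swap
      (integrable_cauchy_kernel c.continuous_γ c.continuous_tangent 0 c.L R)).symm
  have hinner : ∫ s in Ioc 0 c.L, ∫ z in ball (0 : ℂ) R, c.tangent s / (c.γ s - z) =
      ∫ s in Ioc 0 c.L, c.tangent s * (Real.pi * (starRingEnd ℂ) (c.γ s)) := by
    refine setIntegral_congr_fun measurableSet_Ioc fun s hs => ?_
    simp only [div_eq_mul_inv]
    rw [integral_const_mul, integral_ball_inv_sub (hγR s hs)]
  have key : (volume.real Ω : ℂ) = (2 * Real.pi * Complex.I)⁻¹ *
      ∫ s in (0 : ℝ)..c.L, c.tangent s * (Real.pi * (starRingEnd ℂ) (c.γ s)) := by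
    rw [← hwind, intervalIntegral.integral_of_le c.L_pos.le, ← hinner, ← hswap,
      ← integral_const_mul]
    simp only [ElasticLoop.windingNumber, intervalIntegral.integral_of_le c.L_pos.le]
  have hpi : (Real.pi : ℂ) ≠ 0 := by exact_mod_cast Real.pi_ne_zero
  rw [← intervalIntegral.integral_const_mul] at key
  have hcont : Continuous fun s => (2 * Real.pi * Complex.I)⁻¹ *
      (c.tangent s * (Real.pi * (starRingEnd ℂ) (c.γ s))) := by
    have := c.continuous_tangent
    have := c.continuous_γ
    fun_prop
  have hre := congrArg Complex.reCLM key
  rw [← Complex.reCLM.intervalIntegral_comp_comm (hcont.intervalIntegrable _ _)] at hre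
  rw [← intervalIntegral.integral_const_mul]
  simp only [Complex.reCLM_apply, Complex.ofReal_re] at hre
  rw [hre]
  refine intervalIntegral.integral_congr fun s _ => ?_
  have : (2 * Real.pi * Complex.I)⁻¹ * (c.tangent s * (Real.pi * (starRingEnd ℂ) (c.γ s))) =
      ((1 / 2 : ℝ) : ℂ) * (c.normal s * (starRingEnd ℂ) (c.γ s)) := by
    have hI0 := Complex.I_ne_zero
    rw [ElasticLoop.normal, mul_inv, mul_inv, Complex.inv_I]
    push_cast
    field_simp
  simp only [this, Complex.re_ofReal_mul, Complex.inner]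

/-! ### Perturbed loops -/

theorem StrictMono.image_Icc_of_rightInverse {S σ : ℝ → ℝ} (hS : StrictMono S)
    (hσ : ∀ y, S (σ y) = y) (a b : ℝ) : S '' Icc a b = Icc (S a) (S b) := by
  ext y
  constructor
  · rintro ⟨s, hs, rfl⟩
    exact ⟨hS.monotone hs.1, hS.monotone hs.2⟩
  · rintro ⟨h1, h2⟩
    refine ⟨σ y, ⟨?_, ?_⟩, hσ y⟩
    · rwa [← hS.le_iff_le, hσ]
    · rwa [← hS.le_iff_le, hσ]

theorem integral_eq_integral_smul_of_strictMono {E : Type*} [NormedAddCommGroup E]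
    [NormedSpace ℝ E] {S σ q : ℝ → ℝ} (hS : StrictMono S) (hσ : ∀ y, S (σ y) = y)
    (hd : ∀ s, HasDerivAt S (q s) s) (hq : ∀ s, 0 ≤ q s) (F : ℝ → E) {a b : ℝ} (hab : a ≤ b) :
    ∫ y in S a..S b, F y = ∫ s in a..b, q s • F (S s) := by
  rw [intervalIntegral.integral_of_le (hS.monotone hab), intervalIntegral.integral_of_le hab,
    ← integral_Icc_eq_integral_Ioc, ← integral_Icc_eq_integral_Ioc,
    ← hS.image_Icc_of_rightInverse hσ, integral_image_eq_integral_abs_deriv_smul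
      measurableSet_Icc (fun s _ => (hd s).hasDerivWithinAt) hS.injective.injOn]
  simp_rw [abs_of_nonneg (hq _)]

/-- The ratio of the velocity of the perturbed curve `γ + v` to that of `γ` is `1 + w`, where
`w = v' τ̄` is this function. -/
noncomputable def ElasticLoop.relVelocity (c : ElasticLoop) (v' : ℝ → ℂ) (s : ℝ) : ℂ :=
  v' s * (starRingEnd ℂ) (c.tangent s)

/-- The derivative of `relVelocity`. -/
noncomputable def ElasticLoop.relAccel (c : ElasticLoop) (v' v'' : ℝ → ℂ) (s : ℝ) : ℂ :=
  v'' s * (starRingEnd ℂ) (c.tangent s) - Complex.I * c.curvature s * c.relVelocity v' s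

/-- The rate of turning of the curve `γ + v`, with respect to the arc length of `γ`. -/
noncomputable def ElasticLoop.turning (c : ElasticLoop) (v' v'' : ℝ → ℂ) (s : ℝ) : ℝ :=
  c.curvature s + (c.relAccel v' v'' s / (1 + c.relVelocity v' s)).im

/-- The loop `c'` is the curve `γ + v`, parametrized by its arc length `S s`. The function `σ` is the
inverse of `S`, and `v'` is meant to be the derivative of `v`. -/
structure ElasticLoop.IsPerturbation (c c' : ElasticLoop) (v v' : ℝ → ℂ) (S σ : ℝ → ℝ) : Prop where
  hasDerivAt : ∀ s, HasDerivAt S ‖c.tangent s + v' s‖ s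
  speed_ge : ∀ s, 1 / 2 ≤ ‖c.tangent s + v' s‖
  zero : S 0 = 0
  add_period : ∀ s, S (s + c.L) = S s + c'.L
  left_inv : ∀ s, σ (S s) = s
  right_inv : ∀ y, S (σ y) = y
  strictMono : StrictMono S
  hasDerivAt_inv : ∀ y, HasDerivAt σ ‖c.tangent (σ y) + v' (σ y)‖⁻¹ y
  γ_comp : ∀ s, c'.γ (S s) = c.γ s + v s
  tangent_comp : ∀ s, (‖c.tangent s + v' s‖ : ℂ) * c'.tangent (S s) = c.tangent s + v' s

namespace ElasticLoop

variable (c : ElasticLoop)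

theorem norm_relVelocity (v' : ℝ → ℂ) (s : ℝ) : ‖c.relVelocity v' s‖ = ‖v' s‖ := by
  rw [relVelocity, norm_mul, RCLike.norm_conj, norm_tangent, mul_one]

theorem tangent_mul_one_add (v' : ℝ → ℂ) (s : ℝ) :
    c.tangent s * (1 + c.relVelocity v' s) = c.tangent s + v' s := by
  have h := c.conj_tangent_mul s
  rw [relVelocity]
  linear_combination v' s * h

theorem norm_one_add_relVelocity (v' : ℝ → ℂ) (s : ℝ) :
    ‖1 + c.relVelocity v' s‖ = ‖c.tangent s + v' s‖ := by
  rw [← tangent_mul_one_add, norm_mul, norm_tangent, one_mul]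

theorem hasDerivAt_conj_tangent {s : ℝ} (h : HasDerivAt c.θ (c.curvature s) s) :
    HasDerivAt (fun s => (starRingEnd ℂ) (c.tangent s))
      (-(Complex.I * c.curvature s * (starRingEnd ℂ) (c.tangent s))) s := by
  simp_rw [conj_tangent]
  have h1 : HasDerivAt (fun s => -((c.θ s : ℂ) * Complex.I)) (-((c.curvature s : ℂ) * Complex.I)) s :=
    (h.ofReal_comp.mul_const Complex.I).neg
  convert h1.cexp using 1
  ring

theorem hasDerivAt_relVelocity {v' v'' : ℝ → ℂ} {s : ℝ} (h : HasDerivAt c.θ (c.curvature s) s)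
    (hv : HasDerivAt v' (v'' s) s) :
    HasDerivAt (c.relVelocity v') (c.relAccel v' v'' s) s := by
  refine (hv.mul (c.hasDerivAt_conj_tangent h)).congr_deriv ?_
  simp only [relAccel, relVelocity]
  ring

theorem one_add_mem_slitPlane {w : ℂ} (hw : ‖w‖ ≤ 1 / 2) : 1 + w ∈ Complex.slitPlane := by
  refine Or.inl ?_
  have := (abs_le.1 (Complex.abs_re_le_norm w)).1
  simp only [Complex.add_re, Complex.one_re]
  linarith

theorem half_le_norm_one_add {w : ℂ} (hw : ‖w‖ ≤ 1 / 2) : 1 / 2 ≤ ‖1 + w‖ := by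
  have := norm_sub_norm_le (1 : ℂ) (-w)
  rw [norm_one, norm_neg, sub_neg_eq_add] at this
  linarith

theorem continuous_relVelocity {v' : ℝ → ℂ} (hv : Continuous v') :
    Continuous (c.relVelocity v') :=
  hv.mul (Complex.continuous_conj.comp c.continuous_tangent)

theorem measurable_relAccel {v' v'' : ℝ → ℂ} (hv : Continuous v') (hv' : Continuous v'') :
    Measurable (c.relAccel v' v'') := by
  have h1 := (c.continuous_relVelocity hv).measurable
  have h2 := (Complex.continuous_conj.comp c.continuous_tangent).measurable
  have h3 := c.measurable_curvature
  have h4 := hv'.measurable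
  exact (h4.mul h2).sub (((measurable_const.mul (Complex.measurable_ofReal.comp h3))).mul h1)

theorem norm_relAccel_le {v' v'' : ℝ → ℂ} (s : ℝ) :
    ‖c.relAccel v' v'' s‖ ≤ ‖v'' s‖ + |c.curvature s| * ‖v' s‖ := by
  refine (norm_sub_le _ _).trans ?_
  rw [norm_mul, norm_mul, norm_mul, RCLike.norm_conj, norm_tangent, norm_relVelocity,
    Complex.norm_I, Complex.norm_real, Real.norm_eq_abs, mul_one, one_mul]

theorem absolutelyContinuous_relVelocity {v' v'' : ℝ → ℂ} (hv : ∀ s, HasDerivAt v' (v'' s) s)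
    (hv' : Continuous v'') (a b : ℝ) : AbsolutelyContinuousOnInterval (c.relVelocity v') a b := by
  have h1 : AbsolutelyContinuousOnInterval v' a b := by
    have : ContDiff ℝ 1 v' := by
      rw [contDiff_one_iff_deriv, show deriv v' = v'' from funext fun s => (hv s).deriv]
      exact ⟨fun s => (hv s).differentiableAt, hv'⟩
    exact this.contDiffOn.absolutelyContinuousOnInterval
  have hLip : LipschitzWith 1 fun x : ℝ => Complex.exp (-(x * Complex.I)) := by
    have hd : ∀ x : ℝ, HasDerivAt (fun x : ℝ => Complex.exp (-(x * Complex.I)))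
        (Complex.exp (-(x * Complex.I)) * -(1 * Complex.I)) x := fun x =>
      ((Complex.ofRealCLM.hasDerivAt (x := x)).mul_const Complex.I).neg.cexp
    refine lipschitzWith_of_nnnorm_deriv_le (fun x => (hd x).differentiableAt) fun x => ?_
    rw [(hd x).deriv, ← NNReal.coe_le_coe, coe_nnnorm, norm_mul, ← neg_mul,
      ← Complex.ofReal_neg, Complex.norm_exp_ofReal_mul_I]
    simp
  have h2 : AbsolutelyContinuousOnInterval (fun s => (starRingEnd ℂ) (c.tangent s)) a b := by
    have := (c.absolutelyContinuous a b).lipschitzOnWith_comp (lipschitzOnWith_univ.2 hLip)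
      fun _ => mem_univ _
    rw [show (fun s => (starRingEnd ℂ) (c.tangent s)) =
      (fun x : ℝ => Complex.exp (-(x * Complex.I))) ∘ c.θ from funext c.conj_tangent]
    exact this
  exact h1.smul h2

theorem absolutelyContinuous_arg {v' v'' : ℝ → ℂ} (hv : ∀ s, HasDerivAt v' (v'' s) s)
    (hv' : Continuous v'') (hb : ∀ s, ‖v' s‖ ≤ 1 / 2) (a b : ℝ) :
    AbsolutelyContinuousOnInterval (fun s => (Complex.log (1 + c.relVelocity v' s)).im) a b := by
  have hcd : ContDiffOn ℝ 1 (fun w : ℂ => (Complex.log (1 + w)).im) (closedBall 0 (1 / 2)) := by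
    intro w hw
    have h1 : ContDiffAt ℝ 1 Complex.log (1 + w) :=
      (Complex.contDiffAt_log (one_add_mem_slitPlane (mem_closedBall_zero_iff.1 hw))).restrict_scalars ℝ
    have h2 : ContDiffAt ℝ 1 (fun w : ℂ => 1 + w) w := by fun_prop
    exact (Complex.imCLM.contDiff.contDiffAt.comp w (h1.comp w h2)).contDiffWithinAt
  obtain ⟨K, hK⟩ := hcd.exists_lipschitzOnWith (by decide) (convex_closedBall _ _)
    (isCompact_closedBall _ _)
  exact (c.absolutelyContinuous_relVelocity hv hv' a b).lipschitzOnWith_comp hK fun s => by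
    rw [mem_closedBall_zero_iff, norm_relVelocity]
    exact hb s

theorem measurable_turning {v' v'' : ℝ → ℂ} (hv : Continuous v') (hv' : Continuous v'') :
    Measurable (c.turning v' v'') := by
  have h1 := (c.continuous_relVelocity hv).measurable
  exact c.measurable_curvature.add
    (Complex.measurable_im.comp ((c.measurable_relAccel hv hv').div (measurable_const.add h1)))

/-- The density of the elastic energy of the perturbed loop is integrable. -/
theorem integrableOn_turning_sq_div {v' v'' : ℝ → ℂ} (hv : Continuous v') (hv' : Continuous v'')
    (hb : ∀ s, ‖v' s‖ ≤ 1 / 2) (a b : ℝ) :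
    IntegrableOn (fun s => c.turning v' v'' s ^ 2 / ‖c.tangent s + v' s‖) (Icc a b) := by
  obtain ⟨M, hM⟩ := isCompact_Icc.exists_bound_of_continuousOn (s := Icc a b) hv'.continuousOn
  have hk2 : IntegrableOn (fun s => c.curvature s ^ 2) (Icc a b) := by
    rcases le_total a b with hab | hab
    · exact (intervalIntegrable_iff_integrableOn_Icc_of_le hab).1
        (c.intervalIntegrable_curvature_sq a b)
    · refine IntegrableOn.of_measure_zero ?_
      simp [hab]
  refine Integrable.mono' (g := fun s => 36 * c.curvature s ^ 2 + 16 * M ^ 2)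
    ((hk2.const_mul 36).add (integrable_const _)) ?_ ?_
  · exact (((c.measurable_turning hv hv').pow_const 2).div
      (c.continuous_tangent.add hv).norm.measurable).aestronglyMeasurable
  · refine ae_restrict_of_forall_mem measurableSet_Icc fun s hs => ?_
    have hw : ‖c.relVelocity v' s‖ ≤ 1 / 2 := by rw [norm_relVelocity]; exact hb s
    have hq := half_le_norm_one_add hw
    have hnum := c.norm_relAccel_le (v' := v') (v'' := v'') s
    have hM' := hM s hs
    have hkk := abs_nonneg (c.curvature s)
    have hquot : |(c.relAccel v' v'' s / (1 + c.relVelocity v' s)).im| ≤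
        2 * M + |c.curvature s| := by
      refine (Complex.abs_im_le_norm _).trans ?_
      rw [norm_div, div_le_iff₀ (by linarith)]
      have h5 : |c.curvature s| * ‖v' s‖ ≤ |c.curvature s| * (1 / 2) := by
        gcongr
        exact hb s
      have hM0 := (norm_nonneg _).trans hM'
      nlinarith
    have hturn : |c.turning v' v'' s| ≤ 2 * M + 2 * |c.curvature s| := by
      refine (abs_add_le _ _).trans ?_
      linarith
    rw [← norm_one_add_relVelocity, Real.norm_of_nonneg (by positivity),
      div_le_iff₀ (by linarith), ← sq_abs (c.turning v' v'' s), ← sq_abs (c.curvature s)]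
    have h6 : |c.turning v' v'' s| ^ 2 ≤ (2 * M + 2 * |c.curvature s|) ^ 2 := by
      gcongr
    nlinarith [sq_nonneg (M - |c.curvature s|), sq_nonneg |c.curvature s|, sq_nonneg M]

/-- A small periodic perturbation of class `C²` of an elastic loop is an elastic loop, whose tangent
angle is obtained by adding the argument of `1 + w`. -/
theorem exists_isPerturbation {v v' v'' : ℝ → ℂ} (hper : Function.Periodic v c.L)
    (hv : ∀ s, HasDerivAt v (v' s) s) (hv' : ∀ s, HasDerivAt v' (v'' s) s)
    (hv'' : Continuous v'') (hb : ∀ s, ‖v' s‖ ≤ 1 / 2) :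
    ∃ (c' : ElasticLoop) (S σ : ℝ → ℝ), c.IsPerturbation c' v v' S σ ∧
      c'.elasticEnergy =
        (1 / 2) * ∫ s in (0 : ℝ)..c.L, c.turning v' v'' s ^ 2 / ‖c.tangent s + v' s‖ := by
  have hcv' : Continuous v' := continuous_iff_continuousAt.2 fun s => (hv' s).continuousAt
  set q : ℝ → ℝ := fun s => ‖c.tangent s + v' s‖ with hqdef
  have hqc : Continuous q := (c.continuous_tangent.add hcv').norm
  have hw : ∀ s, ‖c.relVelocity v' s‖ ≤ 1 / 2 := fun s => by
    rw [norm_relVelocity]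
    exact hb s
  have hq : ∀ s, 1 / 2 ≤ q s := fun s => by
    rw [hqdef]
    simp only
    rw [← norm_one_add_relVelocity]
    exact half_le_norm_one_add (hw s)
  have hq0 : ∀ s, 0 < q s := fun s => lt_of_lt_of_le (by norm_num) (hq s)
  have hperv' : Function.Periodic v' c.L := by
    intro s
    have h := (hv (s + c.L)).comp_add_const s c.L
    rw [show (fun x => v (x + c.L)) = v from funext hper] at h
    exact h.unique (hv s)
  have hqper : Function.Periodic q c.L := fun s => by
    simp only [hqdef, c.periodic_tangent s, hperv' s]
  set S : ℝ → ℝ := fun s => ∫ x in (0 : ℝ)..s, q x with hSdef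
  have hS : ∀ s, HasDerivAt S (q s) s := fun s => hqc.integral_hasStrictDerivAt 0 s |>.hasDerivAt
  obtain ⟨σ, hσS, hSσ, hSm, hσm, hσd⟩ := exists_inverse_of_deriv_ge (by norm_num) hq hS
  have hS0 : S 0 = 0 := by simp [hSdef]
  have hSadd : ∀ s, S (s + c.L) = S s + S c.L := fun s => by
    have := hqper.intervalIntegral_add_eq_add 0 s fun a b => hqc.intervalIntegrable a b
    rwa [zero_add] at this
  have hLpos : 0 < S c.L := hS0 ▸ hSm c.L_pos
  have hσadd : ∀ y, σ (y + S c.L) = σ y + c.L := fun y => hSm.injective (by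
    rw [hSσ, hSadd, hSσ])
  set ϑ : ℝ → ℝ := fun s => c.θ s + (Complex.log (1 + c.relVelocity v' s)).im with hϑ
  have hexp : ∀ s, (q s : ℂ) * Complex.exp (ϑ s * Complex.I) = c.tangent s + v' s := by
    intro s
    rw [hϑ, ← tangent_mul_one_add]
    simp only
    rw [Complex.log_im]
    push_cast
    rw [add_mul, Complex.exp_add, mul_left_comm, hqdef]
    simp only
    rw [← norm_one_add_relVelocity, Complex.norm_mul_exp_arg_mul_I, tangent]
  have hσLip : LipschitzWith 2 σ := by
    refine lipschitzWith_of_nnnorm_deriv_le (fun y => (hσd y).differentiableAt) fun y => ?_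
    rw [(hσd y).deriv, ← NNReal.coe_le_coe, coe_nnnorm, norm_inv,
      Real.norm_of_nonneg (hq0 _).le, NNReal.coe_ofNat]
    exact inv_le_of_inv_le₀ (by norm_num) (by simpa using hq _)
  have hϑder : ∀ᵐ s, HasDerivAt ϑ (c.turning v' v'' s) s := by
    filter_upwards [c.ae_hasDerivAt_θ] with s hs
    have h1 := ((c.hasDerivAt_relVelocity hs (hv' s)).const_add 1).clog_real
      (one_add_mem_slitPlane (hw s))
    exact hs.add (Complex.imCLM.hasFDerivAt.comp_hasDerivAt s h1)
  have hderiv : ∀ᵐ s, |q s| • deriv (ϑ ∘ σ) (S s) ^ 2 = c.turning v' v'' s ^ 2 / q s := by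
    filter_upwards [hϑder] with s hs
    have h1 : HasDerivAt ϑ (c.turning v' v'' s) (σ (S s)) := by rwa [hσS]
    have h2 := h1.scomp (S s) (hσd (S s))
    rw [h2.deriv, hσS, abs_of_pos (hq0 s)]
    have := (hq0 s).ne'
    simp only [smul_eq_mul]
    field_simp
  have himage : S '' Icc 0 c.L = Icc 0 (S c.L) := by
    rw [hSm.image_Icc_of_rightInverse hSσ, hS0]
  let c' : ElasticLoop :=
    { L := S c.L
      L_pos := hLpos
      γ := fun y => c.γ (σ y) + v (σ y)
      θ := ϑ ∘ σ
      periodic := fun y => by simp only [hσadd, c.periodic (σ y), hper (σ y)]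
      hasDerivAt := fun y => by
        have h1 := ((c.hasDerivAt_γ (σ y)).add (hv (σ y))).scomp y (hσd y)
        refine h1.congr_deriv ?_
        rw [← hexp (σ y), Complex.real_smul, ← mul_assoc, Complex.ofReal_inv, inv_mul_cancel₀,
          one_mul]
        · rfl
        · exact_mod_cast (hq0 _).ne'
      absolutelyContinuous := fun a b =>
        AbsolutelyContinuousOnInterval.comp_strictMono hσm hσLip
          ((c.absolutelyContinuous _ _).add (c.absolutelyContinuous_arg hv' hv'' hb _ _))
      memLp := by
        rw [memLp_two_iff_integrable_sq (measurable_deriv _).aestronglyMeasurable]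
        change IntegrableOn _ _ _
        rw [← himage, integrableOn_image_iff_integrableOn_abs_deriv_smul measurableSet_Icc
          (fun s _ => (hS s).hasDerivWithinAt) hSm.injective.injOn]
        refine (c.integrableOn_turning_sq_div hcv' hv'' hb 0 c.L).congr_fun_ae
          (ae_restrict_of_ae ?_)
        filter_upwards [hderiv] with s hs using hs.symm }
  refine ⟨c', S, σ, ⟨hS, hq, hS0, hSadd, hσS, hSσ, hSm, hσd, fun s => ?_, fun s => ?_⟩, ?_⟩
  · simp only [c', hσS]
  · simp only [c', tangent, Function.comp, hσS]
    exact hexp s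
  · change (1 / 2) * ∫ y in (0 : ℝ)..S c.L, deriv (ϑ ∘ σ) y ^ 2 = _
    rw [show (∫ y in (0 : ℝ)..S c.L, deriv (ϑ ∘ σ) y ^ 2) =
      ∫ y in S 0..S c.L, deriv (ϑ ∘ σ) y ^ 2 by rw [hS0],
      integral_eq_integral_smul_of_strictMono hSm hSσ hS (fun s => (hq0 s).le)
        (fun y => deriv (ϑ ∘ σ) y ^ 2) c.L_pos.le]
    congr 1
    refine intervalIntegral.integral_congr_ae ?_
    filter_upwards [hderiv] with s hs _
    rw [← hs, abs_of_pos (hq0 s)]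

end ElasticLoop

/-! ### Deformation of a loop domain by a diffeomorphism of the plane -/

/-- The map `z ↦ z + X z`, a homeomorphism of the plane when `X` is a contraction of ratio `1/2`. -/
noncomputable def deformation {X : ℂ → ℂ} (hX : LipschitzWith 2⁻¹ X) : ℂ ≃ₜ ℂ :=
  ApproximatesLinearOn.toHomeomorph (fun z => z + X z)
    (f' := ContinuousLinearEquiv.refl ℝ ℂ) (c := 2⁻¹)
    (fun x _ y _ => by
      have h := hX.dist_le_mul x y
      rw [dist_eq_norm, dist_eq_norm] at h
      simpa [add_sub_add_comm] using h)
    (Or.inr (by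
      have h : ‖((ContinuousLinearEquiv.refl ℝ ℂ).symm : ℂ →L[ℝ] ℂ)‖₊ = 1 := by
        rw [← NNReal.coe_inj, coe_nnnorm]
        exact ContinuousLinearMap.norm_id
      rw [h, inv_one]
      exact inv_lt_one_of_one_lt₀ one_lt_two))

theorem deformation_apply {X : ℂ → ℂ} (hX : LipschitzWith 2⁻¹ X) (z : ℂ) :
    deformation hX z = z + X z := rfl

namespace ElasticLoop.IsPerturbation

variable {c c' : ElasticLoop} {v v' : ℝ → ℂ} {S σ : ℝ → ℝ}

theorem period_eq (h : c.IsPerturbation c' v v' S σ) : S c.L = c'.L := by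
  have := h.add_period 0
  rwa [zero_add, h.zero, zero_add] at this

theorem inv_add_period (h : c.IsPerturbation c' v v' S σ) (y : ℝ) :
    σ (y + c'.L) = σ y + c.L := by
  rw [← h.left_inv (σ y + c.L), h.add_period, h.right_inv]

theorem add_int_mul_period (h : c.IsPerturbation c' v v' S σ) (s : ℝ) (n : ℤ) :
    S (s + n * c.L) = S s + n * c'.L := by
  have hp : Function.Periodic (fun s => S s - s * (c'.L / c.L)) c.L := fun s => by
    have := c.L_pos.ne'
    simp only [h.add_period]
    field_simp
    ring
  have h1 := hp.int_mul n s
  have := c.L_pos.ne'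
  field_simp at h1
  refine mul_left_cancel₀ this ?_
  linear_combination h1

/-- Change of variables between the two arc-length parametrizations. -/
theorem integral_eq (h : c.IsPerturbation c' v v' S σ) {E : Type*} [NormedAddCommGroup E]
    [NormedSpace ℝ E] (F : ℝ → E) :
    ∫ y in (0 : ℝ)..c'.L, F y = ∫ s in (0 : ℝ)..c.L, ‖c.tangent s + v' s‖ • F (S s) := by
  have := integral_eq_integral_smul_of_strictMono h.strictMono h.right_inv h.hasDerivAt
    (fun s => norm_nonneg _) F c.L_pos.le
  rwa [h.zero, h.period_eq] at this

theorem range_γ (h : c.IsPerturbation c' v v' S σ) :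
    range c'.γ = range fun s => c.γ s + v s := by
  ext z
  constructor
  · rintro ⟨y, rfl⟩
    exact ⟨σ y, by simp only [← h.γ_comp, h.right_inv]⟩
  · rintro ⟨s, rfl⟩
    exact ⟨S s, h.γ_comp s⟩

theorem integral_inner_normal (h : c.IsPerturbation c' v v' S σ) :
    ∫ y in (0 : ℝ)..c'.L, inner ℝ (c'.γ y) (c'.normal y) =
      ∫ s in (0 : ℝ)..c.L, inner ℝ (c.γ s + v s) (-Complex.I * (c.tangent s + v' s)) := by
  rw [h.integral_eq]
  refine intervalIntegral.integral_congr fun s _ => ?_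
  have h1 : ‖c.tangent s + v' s‖ • c'.normal (S s) = -Complex.I * (c.tangent s + v' s) := by
    rw [Complex.real_smul, normal, mul_left_comm, h.tangent_comp]
  rw [h.γ_comp, smul_eq_mul, ← real_inner_smul_right, h1]

variable {X : ℂ → ℂ}

/-- A deformation of the plane preserves winding numbers: the quotient of the two Cauchy integrands
is a logarithmic derivative of a function that stays in the right half-plane. -/
theorem windingNumber_eq (h : c.IsPerturbation c' v v' S σ) (hX : LipschitzWith 2⁻¹ X)
    (hv : ∀ s, v s = X (c.γ s)) (hv' : ∀ s, HasDerivAt v (v' s) s) (hcv' : Continuous v') {z : ℂ}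
    (hz : z ∉ range c.γ) : c'.windingNumber (z + X z) = c.windingNumber z := by
  have hne : ∀ s, c.γ s - z ≠ 0 := fun s h0 => hz ⟨s, sub_eq_zero.1 h0⟩
  have hXle : ∀ s, ‖v s - X z‖ ≤ 1 / 2 * ‖c.γ s - z‖ := fun s => by
    have := hX.dist_le_mul (c.γ s) z
    rw [dist_eq_norm, dist_eq_norm, ← hv] at this
    simpa using this
  set r : ℝ → ℂ := fun s => (c.γ s + v s - (z + X z)) / (c.γ s - z) with hr
  have hr1 : ∀ s, r s = 1 + (v s - X z) / (c.γ s - z) := fun s => by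
    have := hne s
    rw [hr]
    field_simp
    ring
  have hslit : ∀ s, r s ∈ Complex.slitPlane := fun s => by
    rw [hr1]
    refine one_add_mem_slitPlane ?_
    rw [norm_div, div_le_iff₀ (norm_pos_iff.2 (hne s))]
    exact hXle s
  have hne' : ∀ s, c.γ s + v s - (z + X z) ≠ 0 := fun s h0 => by
    have := Complex.slitPlane_ne_zero (hslit s)
    rw [hr] at this
    simp only [h0, zero_div] at this
    exact this rfl
  have hcv : Continuous v := continuous_iff_continuousAt.2 fun s => (hv' s).continuousAt
  have hc1 : Continuous fun s => (c.tangent s + v' s) / (c.γ s + v s - (z + X z)) :=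
    (c.continuous_tangent.add hcv').div ((c.continuous_γ.add hcv).sub continuous_const) hne'
  have hc2 : Continuous fun s => c.tangent s / (c.γ s - z) :=
    c.continuous_tangent.div (c.continuous_γ.sub continuous_const) hne
  have hlog : ∀ s, HasDerivAt (fun s => Complex.log (r s))
      ((c.tangent s + v' s) / (c.γ s + v s - (z + X z)) - c.tangent s / (c.γ s - z)) s := by
    intro s
    have h1 := (((c.hasDerivAt_γ s).add (hv' s)).sub_const (z + X z)).div
      ((c.hasDerivAt_γ s).sub_const z) (hne s)
    refine (h1.clog_real (hslit s)).congr_deriv ?_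
    have h2 := hne s
    have h3 := hne' s
    simp only [Pi.add_apply, Pi.div_apply]
    field_simp
  have hint : ∫ s in (0 : ℝ)..c.L, ((c.tangent s + v' s) / (c.γ s + v s - (z + X z)) -
      c.tangent s / (c.γ s - z)) = 0 := by
    rw [intervalIntegral.integral_eq_sub_of_hasDerivAt (fun s _ => hlog s)
      ((hc1.sub hc2).intervalIntegrable _ _)]
    have h1 : c.γ c.L = c.γ 0 := by simpa using c.periodic 0
    have h2 : r c.L = r 0 := by simp only [hr, hv, h1]
    rw [h2, sub_self]
  rw [intervalIntegral.integral_sub (hc1.intervalIntegrable _ _) (hc2.intervalIntegrable _ _),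
    sub_eq_zero] at hint
  rw [windingNumber, windingNumber, ← hint, h.integral_eq]
  congr 1
  refine intervalIntegral.integral_congr fun s _ => ?_
  rw [h.γ_comp, Complex.real_smul, ← mul_div_assoc, h.tangent_comp]

theorem isSimpleLoop_comp (h : c.IsPerturbation c' v v' S σ) {η : ℝ → ℂ}
    (hη : IsSimpleLoop c.L η) {φ : ℂ → ℂ} (hφ : Function.Injective φ) :
    IsSimpleLoop c'.L fun y => φ (η (σ y)) := by
  intro s t hst
  obtain ⟨n, hn⟩ := hη _ _ (hφ hst)
  exact ⟨n, by rw [← h.right_inv t, hn, h.add_int_mul_period, h.right_inv]⟩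

theorem isSimpleLoop (h : c.IsPerturbation c' v v' S σ) (hX : LipschitzWith 2⁻¹ X)
    (hv : ∀ s, v s = X (c.γ s)) (hc : IsSimpleLoop c.L c.γ) : IsSimpleLoop c'.L c'.γ := by
  have h1 := h.isSimpleLoop_comp hc (deformation hX).injective
  convert h1 using 1
  ext y
  rw [deformation_apply, ← hv, ← h.γ_comp, h.right_inv]

/-- The simple loops that approximate `γ` are carried along by the deformation and by the change of
parameter; they stay `C¹`-close because `DX` is uniformly continuous. -/
theorem isLimitOfSimpleLoops (h : c.IsPerturbation c' v v' S σ) (hX : LipschitzWith 2⁻¹ X)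
    (hXd : ContDiff ℝ 1 X) (hXs : HasCompactSupport X) (hv : ∀ s, v s = X (c.γ s))
    (hv' : ∀ s, HasDerivAt v (v' s) s) (hcv' : Continuous v') (hc : c.IsLimitOfSimpleLoops) :
    c'.IsLimitOfSimpleLoops := by
  intro ε hε
  set D := fderiv ℝ X
  have hDle : ∀ z, ‖D z‖ ≤ 1 / 2 := fun z => by
    simpa using norm_fderiv_le_of_lipschitz ℝ hX (x₀ := z)
  have hXD : ∀ z, HasFDerivAt X (D z) z := fun z =>
    (hXd.differentiable (by decide) z).hasFDerivAt
  have hDu : UniformContinuous D :=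
    (hXd.continuous_fderiv (by decide)).uniformContinuous_of_tendsto_cocompact
      (x := 0) ((hXs.fderiv ℝ).is_zero_at_infty)
  obtain ⟨δ₁, hδ₁, hDδ⟩ := Metric.uniformContinuous_iff.1 hDu (ε / 8) (by positivity)
  obtain ⟨η, hη, hηp, hηs, hηc⟩ := hc (min δ₁ (ε / 8)) (by positivity)
  have hηd : ∀ s, HasDerivAt η (deriv η s) s := fun s =>
    (hη.differentiable (by decide) s).hasDerivAt
  have hqpos : ∀ s, 0 < ‖c.tangent s + v' s‖ := fun s =>
    lt_of_lt_of_le (by norm_num) (h.speed_ge s)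
  have hv'D : ∀ s, v' s = D (c.γ s) (c.tangent s) := fun s => by
    have h1 := (hXD (c.γ s)).comp_hasDerivAt s (c.hasDerivAt_γ s)
    rw [show X ∘ c.γ = v from funext fun s => (hv s).symm] at h1
    exact (hv' s).unique h1
  have hder : ∀ y, HasDerivAt (fun y => deformation hX (η (σ y)))
      (‖c.tangent (σ y) + v' (σ y)‖⁻¹ • (deriv η (σ y) + D (η (σ y)) (deriv η (σ y)))) y := by
    intro y
    have h1 : HasDerivAt (fun s => η s + X (η s)) (deriv η (σ y) + D (η (σ y)) (deriv η (σ y)))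
        (σ y) := (hηd _).add ((hXD _).comp_hasDerivAt _ (hηd _))
    exact h1.scomp y (h.hasDerivAt_inv y)
  have hσ : ContDiff ℝ 1 σ := by
    rw [contDiff_one_iff_deriv]
    have hcσ : Continuous σ :=
      continuous_iff_continuousAt.2 fun y => (h.hasDerivAt_inv y).continuousAt
    refine ⟨fun y => (h.hasDerivAt_inv y).differentiableAt, ?_⟩
    rw [show deriv σ = fun y => ‖c.tangent (σ y) + v' (σ y)‖⁻¹ from
      funext fun y => (h.hasDerivAt_inv y).deriv]
    refine Continuous.inv₀ ?_ fun y => (hqpos _).ne'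
    exact ((c.continuous_tangent.comp hcσ).add (hcv'.comp hcσ)).norm
  refine ⟨fun y => deformation hX (η (σ y)), ?_, fun y => ?_,
    h.isSimpleLoop_comp hηs (deformation hX).injective, fun y => ?_⟩
  · have h1 := hη.comp hσ
    exact h1.add (hXd.comp h1)
  · simp only [h.inv_add_period, hηp (σ y)]
  · obtain ⟨h1, h2⟩ := hηc (σ y)
    have h1δ := h1.trans_le (min_le_left _ _)
    have h1ε := h1.trans_le (min_le_right _ _)
    have h2ε := h2.trans_le (min_le_right _ _)
    constructor
    · have h3 : c'.γ y - deformation hX (η (σ y)) =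
          (c.γ (σ y) - η (σ y)) + (X (c.γ (σ y)) - X (η (σ y))) := by
        rw [deformation_apply, ← h.right_inv y, h.γ_comp, h.left_inv, hv]
        ring
      have h4 := hX.dist_le_mul (c.γ (σ y)) (η (σ y))
      rw [dist_eq_norm, dist_eq_norm] at h4
      simp only [NNReal.coe_inv, NNReal.coe_ofNat] at h4
      rw [h3]
      refine (norm_add_le _ _).trans_lt ?_
      linarith
    · rw [(hder y).deriv]
      set s := σ y
      have h3 : c'.tangent y = ‖c.tangent s + v' s‖⁻¹ • (c.tangent s + v' s) := by
        have h8 := h.tangent_comp s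
        rw [show S s = y from h.right_inv y] at h8
        rw [Complex.real_smul, Complex.ofReal_inv, eq_inv_mul_iff_mul_eq₀]
        · exact h8
        · exact_mod_cast (hqpos _).ne'
      have h4 : c.tangent s + v' s - (deriv η s + D (η s) (deriv η s)) =
          (c.tangent s - deriv η s) + (D (c.γ s) - D (η s)) (c.tangent s) +
            D (η s) (c.tangent s - deriv η s) := by
        rw [hv'D, sub_apply, map_sub]
        abel
      rw [h3, ← smul_sub, norm_smul, norm_inv, norm_norm, h4]
      have h5 : ‖(D (c.γ s) - D (η s)) (c.tangent s)‖ ≤ ε / 8 := by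
        refine ((D (c.γ s) - D (η s)).le_opNorm _).trans ?_
        rw [norm_tangent, mul_one, ← dist_eq_norm]
        exact (hDδ (by rwa [dist_eq_norm])).le
      have h6 : ‖D (η s) (c.tangent s - deriv η s)‖ ≤ 1 / 2 * (ε / 8) := by
        refine ((D (η s)).le_opNorm _).trans ?_
        gcongr
        exact hDle _
      have h7 : ‖c.tangent s + v' s‖⁻¹ ≤ 2 :=
        inv_le_of_inv_le₀ (by norm_num) (by simpa using h.speed_ge s)
      calc _ ≤ 2 * (ε / 8 + ε / 8 + 1 / 2 * (ε / 8)) := by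
            gcongr
            refine (norm_add_le _ _).trans ?_
            gcongr
            refine (norm_add_le _ _).trans ?_
            gcongr
        _ < ε := by linarith

theorem isLoopDomain (h : c.IsPerturbation c' v v' S σ) (hX : LipschitzWith 2⁻¹ X)
    (hXd : ContDiff ℝ 1 X) (hXs : HasCompactSupport X) (hv : ∀ s, v s = X (c.γ s))
    (hv' : ∀ s, HasDerivAt v (v' s) s) (hcv' : Continuous v') {Ω : Set ℂ}
    (hΩ : IsLoopDomain Ω c) : IsLoopDomain (deformation hX '' Ω) c' := by
  have hrange : range c'.γ = deformation hX '' range c.γ := by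
    rw [h.range_γ, ← range_comp]
    congr 1
    ext s
    simp only [Function.comp, deformation_apply, hv]
  refine ⟨(deformation hX).isOpenMap _ hΩ.isOpen, ?_, fun x p => ?_,
    h.isLimitOfSimpleLoops hX hXd hXs hv hv' hcv' hΩ.limit, ?_, ?_, ?_, ?_⟩
  · have h1 := hΩ.isBounded.isCompact_closure.image (deformation hX).continuous
    exact h1.isBounded.subset (image_mono subset_closure)
  · let e : Ω ≃ₜ deformation hX '' Ω := (deformation hX).image Ω
    obtain ⟨y, rfl⟩ := e.surjective x
    let p' : Path y y := (p.map e.symm.continuous).cast (by simp) (by simp)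
    have h1 := (hΩ.contractible y p').map (⟨e, e.continuous⟩ : C(_, _))
    have h2 : p'.map e.continuous = p := by
      ext t
      simp [p']
    have h3 : (Path.refl y).map e.continuous = Path.refl (e y) := by
      ext t
      simp
    change Path.Homotopic (p'.map e.continuous) ((Path.refl y).map e.continuous) at h1
    rwa [h2, h3] at h1
  · rw [hrange]
    exact (disjoint_image_iff (deformation hX).injective).2 hΩ.disjoint
  · rw [hrange, ← Homeomorph.image_frontier]
    exact image_mono hΩ.frontier_subset
  · rintro _ ⟨z, hz, rfl⟩
    rw [deformation_apply, h.windingNumber_eq hX hv hv' hcv'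
      (Set.disjoint_left.1 hΩ.disjoint hz)]
    exact hΩ.winding_inside z hz
  · intro z' hz1 hz2
    obtain ⟨z, rfl⟩ := (deformation hX).surjective z'
    rw [hrange, (deformation hX).injective.mem_set_image] at hz2
    rw [(deformation hX).injective.mem_set_image] at hz1
    rw [deformation_apply, h.windingNumber_eq hX hv hv' hcv' hz2]
    exact hΩ.winding_outside z hz1 hz2

theorem isJordanDomain (h : c.IsPerturbation c' v v' S σ) (hX : LipschitzWith 2⁻¹ X)
    (hXd : ContDiff ℝ 1 X) (hXs : HasCompactSupport X) (hv : ∀ s, v s = X (c.γ s))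
    (hv' : ∀ s, HasDerivAt v (v' s) s) (hcv' : Continuous v') {Ω : Set ℂ}
    (hΩ : IsJordanDomain Ω c) : IsJordanDomain (deformation hX '' Ω) c' := by
  refine ⟨h.isLoopDomain hX hXd hXs hv hv' hcv' hΩ.toIsLoopDomain,
    (deformation hX).isSimplyConnected_image.2 hΩ.simplyConnected,
    h.isSimpleLoop hX hv hΩ.simple, ?_⟩
  rw [h.range_γ, ← Homeomorph.image_frontier, hΩ.frontier_eq, ← range_comp]
  congr 1
  ext s
  simp only [Function.comp, deformation_apply, hv]

end ElasticLoop.IsPerturbation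

/-! ### Localized deformations along a free branch -/

namespace ElasticLoop

variable (c : ElasticLoop)

theorem lipschitzWith_γ : LipschitzWith 1 c.γ := by
  refine lipschitzWith_of_nnnorm_deriv_le (fun s => (c.hasDerivAt s).differentiableAt) fun s => ?_
  rw [deriv_γ, ← NNReal.coe_le_coe, coe_nnnorm, norm_tangent, NNReal.coe_one]

/-- Away from the period translates of `s₀`, a curve with no self-intersection at `γ s₀` stays at a
positive distance from this point. -/
theorem exists_le_norm_sub {s₀ δ : ℝ}
    (hs₀ : ∀ t, c.γ s₀ = c.γ t → ∃ n : ℤ, t = s₀ + n * c.L) (hδ : 0 < δ) :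
    ∃ r > 0, ∀ s, δ ≤ |s - s₀| → |s - s₀| ≤ c.L - δ → r ≤ ‖c.γ s - c.γ s₀‖ := by
  have hK : IsCompact {s : ℝ | δ ≤ |s - s₀| ∧ |s - s₀| ≤ c.L - δ} := by
    refine (isCompact_closedBall s₀ (c.L - δ)).of_isClosed_subset ?_ fun s hs => ?_
    · have habs : Continuous fun s : ℝ => |s - s₀| := by fun_prop
      exact (isClosed_le continuous_const habs).inter (isClosed_le habs continuous_const)
    · rw [mem_closedBall, Real.dist_eq]
      exact hs.2
  have hcont : Continuous fun s => ‖c.γ s - c.γ s₀‖ :=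
    (c.continuous_γ.sub continuous_const).norm
  obtain ⟨r, hr, h⟩ := hK.exists_forall_le' hcont.continuousOn (a := 0) fun s hs => by
    rw [norm_pos_iff, sub_ne_zero]
    intro heq
    obtain ⟨n, rfl⟩ := hs₀ s heq.symm
    have hs1 := hs.1
    have hs2 := hs.2
    rw [add_sub_cancel_left, abs_mul, abs_of_pos c.L_pos] at hs1 hs2
    have hL := c.L_pos
    rcases eq_or_ne n 0 with h0 | h0
    · simp [h0] at hs1
      linarith
    · have h1 : (1 : ℝ) ≤ |(n : ℝ)| := by exact_mod_cast Int.one_le_abs h0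
      nlinarith
  exact ⟨r, hr, fun s h1 h2 => h s ⟨h1, h2⟩⟩

/-- Near a point without self-intersection, every smooth vector field with small support along the
curve is the restriction of a compactly supported vector field of class `C¹` on the plane. Up to
a cut-off, the field only depends on the abscissa along the tangent at that point. -/
theorem exists_ambient_field {s₀ : ℝ}
    (hs₀ : ∀ t, c.γ s₀ = c.γ t → ∃ n : ℤ, t = s₀ + n * c.L) :
    ∃ δ > 0, δ ≤ c.L / 4 ∧ ∀ V : ℝ → ℂ, ContDiff ℝ 1 V → (∀ s, δ ≤ |s - s₀| → V s = 0) →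
      ∃ X : ℂ → ℂ, ContDiff ℝ 1 X ∧ HasCompactSupport X ∧
        ∀ s, |s - s₀| ≤ 3 * c.L / 4 → X (c.γ s) = V s := by
  set p : ℝ → ℝ := fun u => (c.tangent u * (starRingEnd ℂ) (c.tangent s₀)).re with hp
  have hpc : Continuous p :=
    Complex.continuous_re.comp (c.continuous_tangent.mul continuous_const)
  have hp0 : p s₀ = 1 := by
    rw [hp]
    simp only
    rw [mul_comm, c.conj_tangent_mul, Complex.one_re]
  obtain ⟨δ₁, hδ₁, hpδ⟩ : ∃ δ > 0, ∀ u, |u - s₀| < δ → 1 / 2 < p u := by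
    have h := (hpc.tendsto s₀).eventually (lt_mem_nhds (by rw [hp0]; norm_num : 1 / 2 < p s₀))
    obtain ⟨δ, hδ, h⟩ := Metric.eventually_nhds_iff.1 h
    exact ⟨δ, hδ, fun u hu => h (by rwa [Real.dist_eq])⟩
  have hL := c.L_pos
  set δ₀ := min (δ₁ / 2) (c.L / 4)
  have hδ₀pos : 0 < δ₀ := by positivity
  have hδ₀1 : δ₀ < δ₁ := (min_le_left _ _).trans_lt (by linarith)
  have hδ₀L : δ₀ ≤ c.L / 4 := min_le_right _ _
  obtain ⟨r, hr, hsep⟩ := c.exists_le_norm_sub hs₀ hδ₀pos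
  -- The abscissa along the tangent at `s₀` is extended from the arc near `s₀` to an increasing
  -- function on the line, by freezing its derivative outside of the arc.
  set cl : ℝ → ℝ := fun u => max (s₀ - δ₀) (min u (s₀ + δ₀)) with hcl
  have hcl_eq : ∀ u, |u - s₀| ≤ δ₀ → cl u = u := fun u hu => by
    obtain ⟨h1, h2⟩ := abs_le.1 hu
    rw [hcl]
    simp only
    rw [min_eq_left (by linarith), max_eq_right (by linarith)]
  have hcl_le : ∀ u, |cl u - s₀| ≤ δ₀ := fun u => by
    rw [abs_le]
    constructor
    · have : s₀ - δ₀ ≤ cl u := le_max_left _ _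
      linarith
    · have : cl u ≤ s₀ + δ₀ := max_le (by linarith) (min_le_right _ _)
      linarith
  have hclc : Continuous cl := by fun_prop
  have hqc : Continuous fun u => p (cl u) := hpc.comp hclc
  have hx : ∀ s, HasDerivAt (fun s => ∫ u in s₀..s, p (cl u)) (p (cl s)) s := fun s =>
    (hqc.integral_hasStrictDerivAt s₀ s).hasDerivAt
  obtain ⟨ξ, hξx, hxξ, -, -, hξd⟩ := exists_inverse_of_deriv_ge (m := 1 / 2) (by norm_num)
    (fun s => (hpδ _ ((hcl_le s).trans_lt hδ₀1)).le) hx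
  have hξ1 : ContDiff ℝ 1 ξ := by
    rw [contDiff_one_iff_deriv, show deriv ξ = fun y => (p (cl (ξ y)))⁻¹ from
      funext fun y => (hξd y).deriv]
    have hξc : Continuous ξ := continuous_iff_continuousAt.2 fun y => (hξd y).continuousAt
    refine ⟨fun y => (hξd y).differentiableAt, (hqc.comp hξc).inv₀ fun y => ?_⟩
    exact (lt_trans (by norm_num) (hpδ _ ((hcl_le (ξ y)).trans_lt hδ₀1))).ne'
  set x : ℂ → ℝ := fun z => ((z - c.γ s₀) * (starRingEnd ℂ) (c.tangent s₀)).re with hxdef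
  have hx1 : ContDiff ℝ 1 x :=
    Complex.reCLM.contDiff.comp ((contDiff_id.sub contDiff_const).mul contDiff_const)
  have hxγ : ∀ s, |s - s₀| ≤ δ₀ → ξ (x (c.γ s)) = s := by
    intro s hs
    have hder : ∀ u ∈ uIcc s₀ s, HasDerivAt (fun u => x (c.γ u)) (p u) u := fun u _ =>
      Complex.reCLM.hasFDerivAt.comp_hasDerivAt u
        (((c.hasDerivAt_γ u).sub_const (c.γ s₀)).mul_const _)
    have h1 := intervalIntegral.integral_eq_sub_of_hasDerivAt hder (hpc.intervalIntegrable _ _)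
    have h2 : x (c.γ s₀) = 0 := by simp [hxdef]
    have h3 : ∫ u in s₀..s, p (cl u) = ∫ u in s₀..s, p u := by
      refine intervalIntegral.integral_congr fun u hu => ?_
      rw [hcl_eq u ((abs_sub_left_of_mem_uIcc hu).trans hs)]
    rw [h2, sub_zero, ← h3] at h1
    rw [← h1, hξx]
  set δ := min δ₀ (r / 4) with hδ
  refine ⟨δ, by positivity, (min_le_left _ _).trans hδ₀L, fun V hV hV0 => ?_⟩
  let g : ContDiffBump (c.γ s₀) := ⟨r / 2, r, by positivity, by linarith⟩
  refine ⟨fun z => g z • V (ξ (x z)), g.contDiff.smul (hV.comp (hξ1.comp hx1)),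
    g.hasCompactSupport.smul_right, fun s hs => ?_⟩
  simp only
  rcases le_or_gt |s - s₀| δ₀ with h | h
  · rw [hxγ s h]
    rcases lt_or_ge |s - s₀| δ with h' | h'
    · have h1 : g (c.γ s) = 1 := by
        refine g.one_of_mem_closedBall ?_
        have h2 := c.lipschitzWith_γ.dist_le_mul s s₀
        rw [Real.dist_eq, NNReal.coe_one, one_mul] at h2
        have h3 : δ ≤ r / 4 := min_le_right _ _
        rw [mem_closedBall]
        change _ ≤ r / 2
        linarith
      rw [h1, one_smul]
    · rw [hV0 s h', smul_zero]
  · have h1 : g (c.γ s) = 0 := by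
      refine g.zero_of_le_dist ?_
      rw [dist_eq_norm]
      exact hsep s h.le (by linarith)
    rw [h1, zero_smul, hV0 s ((min_le_left _ _).trans h.le)]

end ElasticLoop

/-! ### The first variation -/

/-- Second-order expansion of the energy density of a perturbed loop: here `w` and `w'` are the
relative velocity and its derivative, and `m` measures the size of the perturbation. -/
theorem sq_turning_div_le {k m A : ℝ} {w w' : ℂ} (hm : m ≤ 1 / 2) (hA : A = 1 + |k|)
    (hw : ‖w‖ ≤ m) (hw' : ‖w'‖ ≤ m * A) :
    (k + (w' / (1 + w)).im) ^ 2 / ‖1 + w‖ ≤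
      k ^ 2 + (2 * k * w'.im - k ^ 2 * w.re) + 22 * (m * A) ^ 2 := by
  have hm0 : 0 ≤ m := (norm_nonneg _).trans hw
  have hk := abs_nonneg k
  have hA1 : 1 ≤ A := by linarith
  have hkA : |k| ≤ A := by linarith
  have hρ := ElasticLoop.half_le_norm_one_add (hw.trans hm)
  have hne : (1 + w) ≠ 0 := norm_pos_iff.1 (by linarith)
  set a := (w' / (1 + w)).im
  set x := w.re
  have hxm : |x| ≤ m := (Complex.abs_re_le_norm w).trans hw
  have hxh : |x| ≤ 1 / 2 := hxm.trans hm
  have hx2 : x ^ 2 ≤ m ^ 2 := sq_le_sq' (by linarith [(abs_le.1 hxm).1]) (abs_le.1 hxm).2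
  have hinv : ‖1 + w‖⁻¹ ≤ 1 - x + 2 * x ^ 2 := by
    have h1 : 1 + x ≤ ‖1 + w‖ := by
      have := Complex.re_le_norm (1 + w)
      simpa using this
    have h2 : 0 < 1 + x := by linarith [(abs_le.1 hxh).1]
    refine (inv_anti₀ h2 h1).trans ?_
    rw [inv_le_iff_one_le_mul₀ h2]
    nlinarith [sq_nonneg x, (abs_le.1 hxh).1]
  have hquot : ‖w' / (1 + w)‖ ≤ 2 * (m * A) := by
    rw [norm_div, div_le_iff₀ (by linarith)]
    nlinarith [mul_nonneg hm0 (zero_le_one.trans hA1)]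
  have haA : |a| ≤ 2 * (m * A) := (Complex.abs_im_le_norm _).trans hquot
  have he : |a - w'.im| ≤ 2 * m * (m * A) := by
    have h1 : w' / (1 + w) - w' = -(w * (w' / (1 + w))) := by
      field_simp
      ring
    have h2 : a - w'.im = (w' / (1 + w) - w').im := by rw [Complex.sub_im]
    rw [h2, h1]
    refine (Complex.abs_im_le_norm _).trans ?_
    rw [norm_neg, norm_mul]
    calc ‖w‖ * ‖w' / (1 + w)‖ ≤ m * (2 * (m * A)) := by gcongr
      _ = 2 * m * (m * A) := by ring
  have haA' : |a| ≤ A := haA.trans (by nlinarith)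
  -- The remainder is the sum of four terms of second order.
  have h1 : 2 * k * (a - w'.im) ≤ 4 * (m * A) ^ 2 := by
    refine (le_abs_self _).trans ?_
    rw [abs_mul, abs_mul, abs_two]
    calc 2 * |k| * |a - w'.im| ≤ 2 * A * (2 * m * (m * A)) := by gcongr
      _ = 4 * (m * A) ^ 2 := by ring
  have h2 : a ^ 2 ≤ 4 * (m * A) ^ 2 := by
    rw [← sq_abs]
    calc |a| ^ 2 ≤ (2 * (m * A)) ^ 2 := by gcongr
      _ = 4 * (m * A) ^ 2 := by ring
  have h3 : -(a * (2 * k + a) * x) ≤ 6 * (m * A) ^ 2 := by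
    refine (neg_le_abs _).trans ?_
    rw [abs_mul, abs_mul]
    have h4 : |2 * k + a| ≤ 3 * A := by
      refine (abs_add_le _ _).trans ?_
      rw [abs_mul, abs_two]
      linarith
    calc |a| * |2 * k + a| * |x| ≤ 2 * (m * A) * (3 * A) * m := by gcongr
      _ = 6 * (m * A) ^ 2 := by ring
  have h4 : 2 * x ^ 2 * (k + a) ^ 2 ≤ 8 * (m * A) ^ 2 := by
    have h5 : |k + a| ≤ 2 * A := (abs_add_le _ _).trans (by linarith)
    rw [← sq_abs (k + a)]
    calc 2 * x ^ 2 * |k + a| ^ 2 ≤ 2 * m ^ 2 * (2 * A) ^ 2 := by gcongr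
      _ = 8 * (m * A) ^ 2 := by ring
  calc (k + a) ^ 2 / ‖1 + w‖ ≤ (k + a) ^ 2 * (1 - x + 2 * x ^ 2) := by
        rw [div_eq_mul_inv]
        gcongr
    _ ≤ _ := by nlinarith

theorem eq_zero_of_forall_nonneg_add_sq {D B t₀ : ℝ} (ht₀ : 0 < t₀)
    (h : ∀ t : ℝ, |t| ≤ t₀ → 0 ≤ t * D + t ^ 2 * B) : D = 0 := by
  by_contra hD
  have hB : 0 < |B| + 1 := by positivity
  have hD' : 0 < |D| := abs_pos.2 hD
  set u := min t₀ (|D| / (2 * (|B| + 1)))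
  have hupos : 0 < u := lt_min ht₀ (by positivity)
  have hu1 : u * (2 * (|B| + 1)) ≤ |D| := by
    rw [← le_div_iff₀ (by positivity)]
    exact min_le_right _ _
  have hut : |u| ≤ t₀ := by
    rw [abs_of_pos hupos]
    exact min_le_left _ _
  have h1 := h u hut
  have h2 := h (-u) (by rwa [abs_neg])
  have h3 : u * |D| ≤ u * (u * |B|) := by
    have h4 := le_abs_self B
    have h5 : u ^ 2 * B ≤ u ^ 2 * |B| := by gcongr
    rcases abs_cases D with ⟨h6, -⟩ | ⟨h6, -⟩ <;> rw [h6] <;> nlinarith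
  have h4 := le_of_mul_le_mul_left h3 hupos
  nlinarith [abs_nonneg B]

namespace ElasticLoop

variable (c : ElasticLoop)

theorem inner_normal (z : ℂ) (s : ℝ) :
    inner ℝ z (c.normal s) = -(z * (starRingEnd ℂ) (c.tangent s)).im := by
  rw [Complex.inner, normal]
  simp
  ring

theorem inner_neg_I_mul_swap (x y : ℂ) :
    inner ℝ x (-Complex.I * y) = -inner ℝ y (-Complex.I * x) := by
  rw [Complex.inner, Complex.inner]
  simp
  ring

theorem im_relAccel (v' v'' : ℝ → ℂ) (s : ℝ) :
    (c.relAccel v' v'' s).im = (v'' s * (starRingEnd ℂ) (c.tangent s)).im -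
      c.curvature s * (c.relVelocity v' s).re := by
  rw [relAccel, Complex.sub_im, mul_assoc Complex.I]
  simp

theorem relVelocity_const_smul (t : ℝ) (v' : ℝ → ℂ) (s : ℝ) :
    c.relVelocity (fun s => t * v' s) s = t * c.relVelocity v' s := by
  rw [relVelocity, relVelocity, mul_assoc]

theorem relAccel_const_smul (t : ℝ) (v' v'' : ℝ → ℂ) (s : ℝ) :
    c.relAccel (fun s => t * v' s) (fun s => t * v'' s) s = t * c.relAccel v' v'' s := by
  rw [relAccel, relVelocity_const_smul, relAccel]
  ring

/-- The integrand of the first variation of `E(∂Ω) + A(Ω)` along the vector field `v`. -/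
noncomputable def variationDensity (v v' v'' : ℝ → ℂ) (s : ℝ) : ℝ :=
  c.curvature s * (v'' s * (starRingEnd ℂ) (c.tangent s)).im -
    3 / 2 * (c.curvature s ^ 2 * (v' s * (starRingEnd ℂ) (c.tangent s)).re) -
      (v s * (starRingEnd ℂ) (c.tangent s)).im

theorem continuous_mul_conj_tangent {f : ℝ → ℂ} (hf : Continuous f) :
    Continuous fun s => f s * (starRingEnd ℂ) (c.tangent s) :=
  hf.mul (Complex.continuous_conj.comp c.continuous_tangent)

/-- The area enclosed by the curve `γ + t v` is a quadratic polynomial in `t`. -/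
theorem integral_inner_normal_add {v v' : ℝ → ℂ} (hper : Function.Periodic v c.L)
    (hv : ∀ s, HasDerivAt v (v' s) s) (hcv' : Continuous v') (t : ℝ) :
    ∫ s in (0 : ℝ)..c.L, inner ℝ (c.γ s + t * v s) (-Complex.I * (c.tangent s + t * v' s)) =
      (∫ s in (0 : ℝ)..c.L, inner ℝ (c.γ s) (c.normal s)) +
        2 * t * (∫ s in (0 : ℝ)..c.L, inner ℝ (v s) (c.normal s)) +
        t ^ 2 * ∫ s in (0 : ℝ)..c.L, inner ℝ (v s) (-Complex.I * v' s) := by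
  have hcv : Continuous v := continuous_iff_continuousAt.2 fun s => (hv s).continuousAt
  have hγ := c.continuous_γ
  have hτ := c.continuous_tangent
  have hν : Continuous c.normal := continuous_const.mul hτ
  have hparts : ∫ s in (0 : ℝ)..c.L,
      (inner ℝ (c.γ s) (-Complex.I * v' s) - inner ℝ (v s) (c.normal s)) = 0 := by
    have hd : ∀ s ∈ uIcc 0 c.L, HasDerivAt (fun s => inner ℝ (c.γ s) (-Complex.I * v s))
        (inner ℝ (c.γ s) (-Complex.I * v' s) - inner ℝ (v s) (c.normal s)) s := by
      intro s _
      refine ((c.hasDerivAt_γ s).inner ℝ ((hv s).const_mul (-Complex.I))).congr_deriv ?_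
      rw [inner_neg_I_mul_swap (c.tangent s) (v s), normal, sub_eq_add_neg]
    rw [intervalIntegral.integral_eq_sub_of_hasDerivAt hd
      (Continuous.intervalIntegrable (by fun_prop) _ _)]
    have h1 : c.γ c.L = c.γ 0 := by simpa using c.periodic 0
    have h2 : v c.L = v 0 := by simpa using hper 0
    rw [h1, h2, sub_self]
  have hexp : ∀ s, (inner ℝ (c.γ s + t * v s) (-Complex.I * (c.tangent s + t * v' s)) : ℝ) =
      inner ℝ (c.γ s) (c.normal s) + 2 * t * inner ℝ (v s) (c.normal s) +
        t ^ 2 * inner ℝ (v s) (-Complex.I * v' s) +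
        t * (inner ℝ (c.γ s) (-Complex.I * v' s) - inner ℝ (v s) (c.normal s)) := by
    intro s
    have h1 : -Complex.I * (c.tangent s + t * v' s) = c.normal s + t • (-Complex.I * v' s) := by
      rw [normal, Complex.real_smul]
      ring
    rw [h1, ← Complex.real_smul]
    simp only [inner_add_left, inner_add_right, real_inner_smul_left, real_inner_smul_right]
    ring
  have i1 : IntervalIntegrable (fun s => (inner ℝ (c.γ s) (c.normal s) : ℝ)) volume 0 c.L :=
    (hγ.inner hν).intervalIntegrable _ _
  have i2 : IntervalIntegrable (fun s => (inner ℝ (v s) (c.normal s) : ℝ)) volume 0 c.L :=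
    (hcv.inner hν).intervalIntegrable _ _
  have i3 : IntervalIntegrable (fun s => (inner ℝ (v s) (-Complex.I * v' s) : ℝ)) volume 0 c.L :=
    (hcv.inner (continuous_const.mul hcv')).intervalIntegrable _ _
  have i4 : IntervalIntegrable (fun s => (inner ℝ (c.γ s) (-Complex.I * v' s) : ℝ)) volume 0 c.L :=
    (hγ.inner (continuous_const.mul hcv')).intervalIntegrable _ _
  simp_rw [hexp]
  rw [intervalIntegral.integral_add ((i1.add (i2.const_mul _)).add (i3.const_mul _))
      ((i4.sub i2).const_mul _),
    intervalIntegral.integral_add (i1.add (i2.const_mul _)) (i3.const_mul _),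
    intervalIntegral.integral_add i1 (i2.const_mul _), intervalIntegral.integral_const_mul,
    intervalIntegral.integral_const_mul, intervalIntegral.integral_const_mul, hparts, mul_zero,
    add_zero]

theorem intervalIntegrable_variationDensity {v v' v'' : ℝ → ℂ} (hv : Continuous v)
    (hv' : Continuous v') (hv'' : Continuous v'') (a b : ℝ) :
    IntervalIntegrable (c.variationDensity v v' v'') volume a b := by
  have h1 := Complex.continuous_im.comp (c.continuous_mul_conj_tangent hv'')
  have h2 := Complex.continuous_re.comp (c.continuous_mul_conj_tangent hv')
  have h3 := Complex.continuous_im.comp (c.continuous_mul_conj_tangent hv)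
  exact (((c.intervalIntegrable_curvature a b).mul_continuousOn h1.continuousOn).sub
    (((c.intervalIntegrable_curvature_sq a b).mul_continuousOn h2.continuousOn).const_mul
      (3 / 2))).sub (h3.intervalIntegrable a b)

/-- The first variation of the energy of a minimizer vanishes along the restriction to the curve of
every compactly supported vector field of the plane. -/
theorem integral_variationDensity_eq_zero {𝒜 : Set ℂ → ElasticLoop → Prop}
    (h𝒜 : 𝒜 = IsJordanDomain ∨ 𝒜 = IsLoopDomain) {Ω : Set ℂ} {c : ElasticLoop}
    (hmin : IsEnergyMinimizer 𝒜 Ω c) {X : ℂ → ℂ} (hXd : ContDiff ℝ 1 X) (hXs : HasCompactSupport X)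
    {v v' v'' : ℝ → ℂ} (hvX : ∀ s, v s = X (c.γ s)) (hv : ∀ s, HasDerivAt v (v' s) s)
    (hv' : ∀ s, HasDerivAt v' (v'' s) s) (hcv'' : Continuous v'') :
    ∫ s in (0 : ℝ)..c.L, c.variationDensity v v' v'' s = 0 := by
  have hcv : Continuous v := continuous_iff_continuousAt.2 fun s => (hv s).continuousAt
  have hcv' : Continuous v' := continuous_iff_continuousAt.2 fun s => (hv' s).continuousAt
  have hper : Function.Periodic v c.L := fun s => by simp only [hvX, c.periodic s]
  obtain ⟨K, hK⟩ := hXd.lipschitzWith_of_hasCompactSupport hXs (by decide)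
  have hvK : ∀ s, ‖v' s‖ ≤ K := fun s => by
    have h1 : LipschitzWith K v := by
      have := hK.comp c.lipschitzWith_γ
      rw [mul_one] at this
      rwa [show v = X ∘ c.γ from funext hvX]
    exact (hv s).le_of_lipschitz h1
  obtain ⟨M₁, hM₁⟩ := isCompact_Icc.exists_bound_of_continuousOn (s := Icc 0 c.L)
    hcv''.continuousOn
  set M : ℝ := K + |M₁| + 1
  have hK0 : (0 : ℝ) ≤ K := K.2
  have hM0 : 0 < M := by positivity
  have hKM : (K : ℝ) ≤ M := by
    have := abs_nonneg M₁
    linarith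
  set P : ℝ := ∫ s in (0 : ℝ)..c.L, (1 + c.curvature s ^ 2)
  set Q : ℝ := ∫ s in (0 : ℝ)..c.L, inner ℝ (v s) (-Complex.I * v' s)
  have hL0 := c.L_pos.le
  -- The energy density of `γ` and its first variation.
  set d : ℝ → ℝ := fun s => 2 * c.curvature s * (c.relAccel v' v'' s).im -
    c.curvature s ^ 2 * (c.relVelocity v' s).re with hd
  have hdens : ∀ s, c.variationDensity v v' v'' s = 1 / 2 * d s + inner ℝ (v s) (c.normal s) := by
    intro s
    rw [variationDensity, hd, inner_normal]
    simp only [im_relAccel, relVelocity]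
    ring
  have iN : IntervalIntegrable (fun s => (inner ℝ (v s) (c.normal s) : ℝ)) volume 0 c.L :=
    (hcv.inner (continuous_const.mul c.continuous_tangent)).intervalIntegrable _ _
  have iD : IntervalIntegrable d volume 0 c.L := by
    have := ((c.intervalIntegrable_variationDensity hcv hcv' hcv'' 0 c.L).sub iN).const_mul 2
    refine this.congr (fun s _ => ?_)
    simp only [hdens]
    ring
  have iK := c.intervalIntegrable_curvature_sq 0 c.L
  have i1 : IntervalIntegrable (fun s => 1 + c.curvature s ^ 2) volume 0 c.L :=
    (intervalIntegrable_const).add iK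
  refine eq_zero_of_forall_nonneg_add_sq (t₀ := 1 / (2 * M)) (B := 22 * M ^ 2 * P + 1 / 2 * Q)
    (by positivity) fun t ht => ?_
  have htM : |t| * M ≤ 1 / 2 := by
    rw [le_div_iff₀ (by positivity)] at ht
    linarith
  have htK : ∀ s, ‖(t : ℂ) * v' s‖ ≤ 1 / 2 := fun s => by
    rw [norm_mul, Complex.norm_real, Real.norm_eq_abs]
    refine le_trans ?_ htM
    gcongr
    exact (hvK s).trans hKM
  have hXt : LipschitzWith 2⁻¹ fun z => (t : ℂ) * X z := by
    refine LipschitzWith.of_dist_le_mul fun x y => ?_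
    rw [dist_eq_norm, ← mul_sub, norm_mul, Complex.norm_real, Real.norm_eq_abs, ← dist_eq_norm]
    have h1 := hK.dist_le_mul x y
    have h2 := dist_nonneg (x := x) (y := y)
    calc |t| * dist (X x) (X y) ≤ |t| * (M * dist x y) := by
          gcongr
          exact h1.trans (by gcongr)
      _ = |t| * M * dist x y := by ring
      _ ≤ 1 / 2 * dist x y := by gcongr
      _ = _ := by simp
  have hXtd : ContDiff ℝ 1 fun z => (t : ℂ) * X z := contDiff_const.mul hXd
  have hXts : HasCompactSupport fun z => (t : ℂ) * X z := hXs.mul_left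
  have hvt : ∀ s, HasDerivAt (fun s => (t : ℂ) * v s) (t * v' s) s := fun s => (hv s).const_mul _
  have hcvt' : Continuous fun s => (t : ℂ) * v' s := continuous_const.mul hcv'
  have hcvt'' : Continuous fun s => (t : ℂ) * v'' s := continuous_const.mul hcv''
  have hXv : ∀ s, (t : ℂ) * v s = t * X (c.γ s) := fun s => by rw [hvX]
  obtain ⟨c', S, σ, hpert, hE⟩ := c.exists_isPerturbation (v := fun s => (t : ℂ) * v s)
    (fun s => by simp only [hper s]) hvt (fun s => (hv' s).const_mul _) hcvt'' htK
  have hle : totalEnergy Ω c ≤ totalEnergy (deformation hXt '' Ω) c' := by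
    refine hmin.2 _ _ ?_
    have h1 := hmin.1
    rcases h𝒜 with h | h <;> rw [h] at h1 ⊢
    · exact hpert.isJordanDomain hXt hXtd hXts hXv hvt hcvt' h1
    · exact hpert.isLoopDomain hXt hXtd hXts hXv hvt hcvt' h1
  have hloop : IsLoopDomain Ω c := by
    have h1 := hmin.1
    rcases h𝒜 with h | h <;> rw [h] at h1
    · exact h1.toIsLoopDomain
    · exact h1
  have hA : volume.real (deformation hXt '' Ω) =
      volume.real Ω + t * (∫ s in (0 : ℝ)..c.L, inner ℝ (v s) (c.normal s)) +
        1 / 2 * t ^ 2 * Q := by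
    rw [(hpert.isLoopDomain hXt hXtd hXts hXv hvt hcvt' hloop).volume_real_eq,
      hpert.integral_inner_normal, c.integral_inner_normal_add hper hv hcv',
      hloop.volume_real_eq]
    ring
  have hE' : c'.elasticEnergy ≤ c.elasticEnergy + 1 / 2 * (t * ∫ s in (0 : ℝ)..c.L, d s) +
      22 * (t * M) ^ 2 * P := by
    have hmono : ∫ s in (0 : ℝ)..c.L,
          c.turning (fun s => t * v' s) (fun s => t * v'' s) s ^ 2 / ‖c.tangent s + t * v' s‖ ≤
        ∫ s in (0 : ℝ)..c.L,
          (c.curvature s ^ 2 + t * d s + 44 * (t * M) ^ 2 * (1 + c.curvature s ^ 2)) := by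
      refine intervalIntegral.integral_mono_on hL0 ?_
        ((iK.add (iD.const_mul _)).add (i1.const_mul _)) fun s hs => ?_
      · rw [intervalIntegrable_iff_integrableOn_Icc_of_le hL0]
        exact c.integrableOn_turning_sq_div hcvt' hcvt'' htK 0 c.L
      · have hw : ‖(t : ℂ) * c.relVelocity v' s‖ ≤ |t| * M := by
          rw [norm_mul, Complex.norm_real, Real.norm_eq_abs, norm_relVelocity]
          gcongr
          exact (hvK s).trans hKM
        have hw' : ‖(t : ℂ) * c.relAccel v' v'' s‖ ≤ |t| * M * (1 + |c.curvature s|) := by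
          rw [norm_mul, Complex.norm_real, Real.norm_eq_abs, mul_assoc]
          gcongr
          refine (c.norm_relAccel_le s).trans ?_
          have h1 := hM₁ s hs
          have h2 := le_abs_self M₁
          have h3 : |c.curvature s| * ‖v' s‖ ≤ |c.curvature s| * M := by
            gcongr
            exact (hvK s).trans hKM
          linarith
        have h1 := sq_turning_div_le htM rfl hw hw'
        have h2 : c.turning (fun s => t * v' s) (fun s => t * v'' s) s ^ 2 /
            ‖c.tangent s + t * v' s‖ = (c.curvature s + ((t : ℂ) * c.relAccel v' v'' s /
              (1 + t * c.relVelocity v' s)).im) ^ 2 / ‖1 + (t : ℂ) * c.relVelocity v' s‖ := by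
          rw [← relVelocity_const_smul, norm_one_add_relVelocity, turning, relAccel_const_smul]
        rw [h2]
        refine h1.trans ?_
        have h3 : (|t| * M * (1 + |c.curvature s|)) ^ 2 ≤
            (t * M) ^ 2 * (2 * (1 + c.curvature s ^ 2)) := by
          rw [mul_pow, mul_pow, mul_pow, sq_abs]
          gcongr
          nlinarith [sq_nonneg (1 - |c.curvature s|), sq_abs (c.curvature s)]
        rw [Complex.re_ofReal_mul, Complex.im_ofReal_mul]
        simp only [hd]
        nlinarith
    rw [hE, elasticEnergy]
    rw [intervalIntegral.integral_add (iK.add (iD.const_mul _)) (i1.const_mul _),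
      intervalIntegral.integral_add iK (iD.const_mul _), intervalIntegral.integral_const_mul,
      intervalIntegral.integral_const_mul] at hmono
    linarith
  have hD : ∫ s in (0 : ℝ)..c.L, c.variationDensity v v' v'' s =
      1 / 2 * (∫ s in (0 : ℝ)..c.L, d s) + ∫ s in (0 : ℝ)..c.L, inner ℝ (v s) (c.normal s) := by
    simp_rw [hdens]
    rw [intervalIntegral.integral_add (iD.const_mul _) iN, intervalIntegral.integral_const_mul]
  rw [totalEnergy, totalEnergy, hA] at hle
  rw [hD]
  nlinarith

end ElasticLoop

/-! ### The du Bois-Reymond lemma -/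

/-- A smooth function on the line, compactly supported in the open interval of centre `s₀` and
radius `δ`. -/
structure IsTestFunction (s₀ δ : ℝ) (g : ℝ → ℝ) : Prop where
  contDiff : ContDiff ℝ ∞ g
  exists_radius : ∃ r, 0 ≤ r ∧ r < δ ∧ ∀ s, r ≤ |s - s₀| → g s = 0

namespace IsTestFunction

variable {s₀ δ : ℝ} {g : ℝ → ℝ}

theorem eq_zero (hg : IsTestFunction s₀ δ g) {s : ℝ} (hs : δ ≤ |s - s₀|) : g s = 0 := by
  obtain ⟨r, hr0, hr, h⟩ := hg.exists_radius
  exact h s (hr.le.trans hs)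

theorem left_eq_zero (hg : IsTestFunction s₀ δ g) : g (s₀ - δ) = 0 :=
  hg.eq_zero (by rw [sub_sub_cancel_left, abs_neg]; exact le_abs_self δ)

theorem right_eq_zero (hg : IsTestFunction s₀ δ g) : g (s₀ + δ) = 0 :=
  hg.eq_zero (by rw [add_sub_cancel_left]; exact le_abs_self δ)

theorem hasDerivAt (hg : IsTestFunction s₀ δ g) (s : ℝ) : HasDerivAt g (deriv g s) s :=
  (hg.contDiff.differentiable (by simp) s).hasDerivAt

theorem deriv (hg : IsTestFunction s₀ δ g) : IsTestFunction s₀ δ (deriv g) := by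
  obtain ⟨r, hr0, hr, h⟩ := hg.exists_radius
  refine ⟨(contDiff_infty_iff_deriv.1 hg.contDiff).2, (r + δ) / 2, by linarith, by linarith, fun s hs => ?_⟩
  have h1 : g =ᶠ[nhds s] fun _ => 0 := by
    have hcont : Continuous fun x : ℝ => |x - s₀| := by fun_prop
    filter_upwards [(hcont.tendsto s).eventually (lt_mem_nhds (by linarith : r < |s - s₀|))]
      with x hx using h x hx.le
  rw [h1.deriv_eq, deriv_const]

theorem sub_const_mul {h : ℝ → ℝ} (hg : IsTestFunction s₀ δ g) (hh : IsTestFunction s₀ δ h)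
    (m : ℝ) : IsTestFunction s₀ δ fun s => g s - m * h s := by
  obtain ⟨r, hr0, hr, h1⟩ := hg.exists_radius
  obtain ⟨r', -, hr', h2⟩ := hh.exists_radius
  refine ⟨hg.contDiff.sub (contDiff_const.mul hh.contDiff), max r r', hr0.trans (le_max_left _ _),
    max_lt hr hr', fun s hs => ?_⟩
  rw [h1 s ((le_max_left _ _).trans hs), h2 s ((le_max_right _ _).trans hs), mul_zero, sub_zero]

/-- A test function of mean zero is the derivative of a test function. -/
theorem exists_primitive (hg : IsTestFunction s₀ δ g) (h0 : ∫ s in s₀ - δ..s₀ + δ, g s = 0) :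
    ∃ G, IsTestFunction s₀ δ G ∧ _root_.deriv G = g := by
  have hgc : Continuous g := hg.contDiff.continuous
  have hG : ∀ s, HasDerivAt (fun s => ∫ x in s₀ - δ..s, g x) (g s) s := fun s =>
    (hgc.integral_hasStrictDerivAt _ s).hasDerivAt
  have hGd : _root_.deriv (fun s => ∫ x in s₀ - δ..s, g x) = g := funext fun s => (hG s).deriv
  refine ⟨fun s => ∫ x in s₀ - δ..s, g x, ⟨?_, ?_⟩, hGd⟩
  · rw [contDiff_infty_iff_deriv, hGd]
    exact ⟨fun s => (hG s).differentiableAt, hg.contDiff⟩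
  · obtain ⟨r, hr0, hr, h⟩ := hg.exists_radius
    have hzero : ∀ a b, (∀ x ∈ uIcc a b, r ≤ |x - s₀|) → ∫ x in a..b, g x = 0 := by
      intro a b hab
      rw [intervalIntegral.integral_congr (g := fun _ => (0 : ℝ)) fun x hx => h x (hab x hx)]
      simp
    refine ⟨r, hr0, hr, fun s hs => ?_⟩
    rcases le_abs'.1 hs with h1 | h1
    · refine hzero _ _ fun x hx => le_abs'.2 (Or.inl ?_)
      have : x ≤ max (s₀ - δ) s := hx.2
      rcases le_max_iff.1 this with h2 | h2 <;> linarith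
    · rw [← intervalIntegral.integral_add_adjacent_intervals (hgc.intervalIntegrable _ (s₀ + δ))
        (hgc.intervalIntegrable _ _), h0, zero_add]
      refine hzero _ _ fun x hx => le_abs'.2 (Or.inr ?_)
      have : min (s₀ + δ) s ≤ x := hx.1
      rcases min_le_iff.1 this with h2 | h2 <;> linarith

/-- Integration by parts of a test function against a primitive of an integrable function. -/
theorem integral_mul_eq_neg (hg : IsTestFunction s₀ δ g) {f : ℝ → ℝ}
    (hf : ∀ a b, IntervalIntegrable f volume a b) (a : ℝ) :
    ∫ s in s₀ - δ..s₀ + δ, g s * f s =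
      -∫ s in s₀ - δ..s₀ + δ, _root_.deriv g s * ∫ x in a..s, f x := by
  set α := min a (s₀ - δ)
  set β := max a (s₀ + δ)
  have hδ : 0 ≤ δ := by
    obtain ⟨r, hr0, hr, -⟩ := hg.exists_radius
    linarith
  have ha : a ∈ uIcc α β := by
    rw [uIcc_of_le ((min_le_left _ _).trans (le_max_left _ _))]
    exact ⟨min_le_left _ _, le_max_left _ _⟩
  have hsub : uIcc (s₀ - δ) (s₀ + δ) ⊆ uIcc α β := by
    rw [uIcc_of_le (by linarith), uIcc_of_le ((min_le_left _ _).trans (le_max_left _ _))]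
    exact Icc_subset_Icc (min_le_right _ _) (le_max_right _ _)
  have hF : AbsolutelyContinuousOnInterval (fun s => ∫ x in a..s, f x) (s₀ - δ) (s₀ + δ) :=
    ((hf α β).absolutelyContinuousOnInterval_intervalIntegral ha).mono hsub
  have hgac : AbsolutelyContinuousOnInterval g (s₀ - δ) (s₀ + δ) :=
    (hg.contDiff.of_le (by simp)).contDiffOn.absolutelyContinuousOnInterval
  have h1 := hgac.integral_mul_deriv_eq_deriv_mul hF
  rw [hg.left_eq_zero, hg.right_eq_zero, zero_mul, zero_mul, sub_zero, zero_sub] at h1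
  rw [← h1]
  refine intervalIntegral.integral_congr_ae ?_
  filter_upwards [(hf α β).ae_hasDerivAt_integral] with s hs hs'
  rw [(hs (hsub (uIoc_subset_uIcc hs')) a ha).deriv]

theorem integral_eq_neg (hg : IsTestFunction s₀ δ g) :
    ∫ s in s₀ - δ..s₀ + δ, g s = -∫ s in s₀ - δ..s₀ + δ, _root_.deriv g s * s := by
  have h1 := hg.integral_mul_eq_neg (f := fun _ => 1) (fun a b => intervalIntegrable_const) 0
  simpa using h1

theorem intervalIntegrable_mul (hg : IsTestFunction s₀ δ g) {f : ℝ → ℝ}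
    (hf : ∀ a b, IntervalIntegrable f volume a b) (a b : ℝ) :
    IntervalIntegrable (fun s => g s * f s) volume a b :=
  (hf a b).continuousOn_mul hg.contDiff.continuous.continuousOn

end IsTestFunction

theorem exists_isTestFunction_integral_eq_one (s₀ : ℝ) {δ : ℝ} (hδ : 0 < δ) :
    ∃ ρ, IsTestFunction s₀ δ ρ ∧ ∫ s in s₀ - δ..s₀ + δ, ρ s = 1 := by
  let φ : ContDiffBump s₀ := ⟨δ / 4, δ / 2, by positivity, by linarith⟩
  have h0 : ∀ s, δ / 2 ≤ |s - s₀| → φ.normed volume s = 0 := fun s hs => by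
    rw [φ.normed_def, φ.zero_of_le_dist (by rwa [Real.dist_eq]), zero_div]
  refine ⟨φ.normed volume, ⟨φ.contDiff_normed, δ / 2, by positivity, by linarith, h0⟩, ?_⟩
  rw [intervalIntegral.integral_eq_integral_of_support_subset, φ.integral_normed]
  intro s hs
  by_contra hs'
  refine hs (h0 s ?_)
  rw [mem_Ioc, not_and_or, not_lt, not_le] at hs'
  rw [le_abs']
  rcases hs' with h | h
  · left; linarith
  · right; linarith

theorem ae_eq_zero_of_integral_isTestFunction_mul {s₀ δ : ℝ} (hδ : 0 < δ) {f : ℝ → ℝ}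
    (hf : ∀ a b, IntervalIntegrable f volume a b)
    (h : ∀ g, IsTestFunction s₀ δ g → ∫ s in s₀ - δ..s₀ + δ, g s * f s = 0) :
    ∀ᵐ s, s ∈ ball s₀ δ → f s = 0 := by
  refine isOpen_ball.ae_eq_zero_of_integral_contDiff_smul_eq_zero ?_ fun g hg _ hsupp => ?_
  · refine IntegrableOn.locallyIntegrableOn ?_
    rw [Real.ball_eq_Ioo]
    exact ((intervalIntegrable_iff_integrableOn_Ioc_of_le (by linarith)).1
      (hf (s₀ - δ) (s₀ + δ))).mono_set Ioo_subset_Ioc_self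
  · obtain ⟨r, hr, hsub⟩ := exists_pos_lt_subset_ball hδ (isClosed_tsupport g) hsupp
    have hg0 : ∀ s, r ≤ |s - s₀| → g s = 0 := fun s hs => by
      refine image_eq_zero_of_notMem_tsupport fun hmem => ?_
      have := hsub hmem
      rw [mem_ball, Real.dist_eq] at this
      linarith
    have hr2 := hr.2
    rw [← h g ⟨hg, r, hr.1.le, hr.2, hg0⟩,
      intervalIntegral.integral_eq_integral_of_support_subset]
    · rfl
    · intro s hs
      by_contra hs'
      refine hs ?_
      simp only
      rw [hg0 s, zero_mul]
      rw [mem_Ioc, not_and_or, not_lt, not_le] at hs'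
      rw [le_abs']
      rcases hs' with h | h
      · left; linarith
      · right; linarith

/-- A function whose distributional derivative vanishes is constant. -/
theorem ae_eq_const_of_integral_deriv_mul_eq_zero {s₀ δ : ℝ} (hδ : 0 < δ) {f : ℝ → ℝ}
    (hf : ∀ a b, IntervalIntegrable f volume a b)
    (h : ∀ g, IsTestFunction s₀ δ g → ∫ s in s₀ - δ..s₀ + δ, deriv g s * f s = 0) :
    ∃ C, ∀ᵐ s, s ∈ ball s₀ δ → f s = C := by
  obtain ⟨ρ, hρ, hρ1⟩ := exists_isTestFunction_integral_eq_one s₀ hδ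
  set C := ∫ s in s₀ - δ..s₀ + δ, ρ s * f s
  refine ⟨C, ?_⟩
  suffices key : ∀ᵐ s, s ∈ ball s₀ δ → f s - C = 0 by
    filter_upwards [key] with s hs hs'
    exact sub_eq_zero.1 (hs hs')
  refine ae_eq_zero_of_integral_isTestFunction_mul (f := fun s => f s - C) hδ
    (fun a b => (hf a b).sub intervalIntegrable_const) fun g hg => ?_
  set m := ∫ s in s₀ - δ..s₀ + δ, g s
  have ig := hg.contDiff.continuous.intervalIntegrable (μ := volume) (s₀ - δ) (s₀ + δ)
  have iρ := hρ.contDiff.continuous.intervalIntegrable (μ := volume) (s₀ - δ) (s₀ + δ)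
  obtain ⟨G, hG, hGd⟩ := (hg.sub_const_mul hρ m).exists_primitive (by
    rw [intervalIntegral.integral_sub ig (iρ.const_mul _), intervalIntegral.integral_const_mul,
      hρ1, mul_one, sub_self])
  have h1 := h G hG
  rw [hGd] at h1
  have h2 : ∀ s, (g s - m * ρ s) * f s = g s * f s - m * (ρ s * f s) := fun s => by ring
  simp_rw [h2] at h1
  rw [intervalIntegral.integral_sub (hg.intervalIntegrable_mul hf _ _)
    ((hρ.intervalIntegrable_mul hf _ _).const_mul _), intervalIntegral.integral_const_mul] at h1
  simp_rw [mul_sub]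
  rw [intervalIntegral.integral_sub (hg.intervalIntegrable_mul hf _ _) (ig.mul_const _),
    intervalIntegral.integral_mul_const]
  exact h1

/-- A function whose second distributional derivative vanishes is affine. -/
theorem ae_eq_affine_of_integral_deriv_deriv_mul_eq_zero {s₀ δ : ℝ} (hδ : 0 < δ) {f : ℝ → ℝ}
    (hf : ∀ a b, IntervalIntegrable f volume a b)
    (h : ∀ g, IsTestFunction s₀ δ g → ∫ s in s₀ - δ..s₀ + δ, deriv (deriv g) s * f s = 0) :
    ∃ A B : ℝ, ∀ᵐ s, s ∈ ball s₀ δ → f s = A + B * s := by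
  obtain ⟨ρ, hρ, hρ1⟩ := exists_isTestFunction_integral_eq_one s₀ hδ
  set T := ∫ s in s₀ - δ..s₀ + δ, deriv ρ s * f s
  have iid : ∀ a b, IntervalIntegrable (fun s : ℝ => T * s) volume a b := fun a b =>
    (continuous_const.mul continuous_id).intervalIntegrable _ _
  suffices key : ∃ C, ∀ᵐ s, s ∈ ball s₀ δ → f s + T * s = C by
    obtain ⟨C, hC⟩ := key
    refine ⟨C, -T, ?_⟩
    filter_upwards [hC] with s hs hs'
    linarith [hs hs']
  refine ae_eq_const_of_integral_deriv_mul_eq_zero (f := fun s => f s + T * s) hδ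
    (fun a b => (hf a b).add (iid a b)) fun g hg => ?_
  set m := ∫ s in s₀ - δ..s₀ + δ, g s
  have ig := hg.contDiff.continuous.intervalIntegrable (μ := volume) (s₀ - δ) (s₀ + δ)
  have iρ := hρ.contDiff.continuous.intervalIntegrable (μ := volume) (s₀ - δ) (s₀ + δ)
  obtain ⟨G, hG, hGd⟩ := (hg.sub_const_mul hρ m).exists_primitive (by
    rw [intervalIntegral.integral_sub ig (iρ.const_mul _), intervalIntegral.integral_const_mul,
      hρ1, mul_one, sub_self])
  have h1 := h G hG
  have h2 : ∀ s, deriv (deriv G) s * f s = deriv g s * f s - m * (deriv ρ s * f s) := fun s => by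
    rw [hGd, ((hg.hasDerivAt s).fun_sub ((hρ.hasDerivAt s).const_mul m)).deriv]
    ring
  simp_rw [h2] at h1
  rw [intervalIntegral.integral_sub (hg.deriv.intervalIntegrable_mul hf _ _)
    ((hρ.deriv.intervalIntegrable_mul hf _ _).const_mul _),
    intervalIntegral.integral_const_mul] at h1
  have h3 := hg.integral_eq_neg
  simp_rw [mul_add]
  rw [intervalIntegral.integral_add (hg.deriv.intervalIntegrable_mul hf _ _)
    (hg.deriv.intervalIntegrable_mul iid _ _)]
  have h4 : ∀ s, deriv g s * (T * s) = T * (deriv g s * s) := fun s => by ring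
  simp_rw [h4]
  rw [intervalIntegral.integral_const_mul]
  linear_combination h1 + T * h3

/-! ### The Euler equation near a point without self-intersection -/

namespace ElasticLoop

variable (c : ElasticLoop)

/-- The Euler equation in weak form: the first variation vanishes along every vector field of
constant direction and small support along the curve. -/
theorem exists_integral_variationDensity_isTestFunction {𝒜 : Set ℂ → ElasticLoop → Prop}
    (h𝒜 : 𝒜 = IsJordanDomain ∨ 𝒜 = IsLoopDomain) {Ω : Set ℂ} {c : ElasticLoop}
    (hmin : IsEnergyMinimizer 𝒜 Ω c) {s₀ : ℝ}
    (hs₀ : ∀ t, c.γ s₀ = c.γ t → ∃ n : ℤ, t = s₀ + n * c.L) :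
    ∃ δ > 0, ∀ (e : ℂ) (g : ℝ → ℝ), IsTestFunction s₀ δ g →
      ∫ s in s₀ - δ..s₀ + δ, c.variationDensity (fun s => g s * e) (fun s => deriv g s * e)
        (fun s => deriv (deriv g) s * e) s = 0 := by
  obtain ⟨δ, hδ, hδL, hfield⟩ := c.exists_ambient_field hs₀
  have hL := c.L_pos
  refine ⟨δ, hδ, fun e g hg => ?_⟩
  set V : ℝ → ℂ := fun s => g s * e with hVdef
  have hV : ContDiff ℝ ∞ V := (Complex.ofRealCLM.contDiff.comp hg.contDiff).mul contDiff_const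
  have hV1 : ∀ s, HasDerivAt V (deriv g s * e) s := fun s =>
    (hg.hasDerivAt s).ofReal_comp.mul_const e
  have hV2 : ∀ s, HasDerivAt (fun s => ((deriv g s : ℝ) : ℂ) * e) (deriv (deriv g) s * e) s := fun s =>
    (hg.deriv.hasDerivAt s).ofReal_comp.mul_const e
  obtain ⟨X, hXd, hXs, hXV⟩ := hfield V (hV.of_le (by simp)) fun s hs => by
    simp only [hVdef, hg.eq_zero hs, Complex.ofReal_zero, zero_mul]
  set v : ℝ → ℂ := fun s => X (c.γ s) with hv
  have hper : Function.Periodic v c.L := fun s => by simp only [hv, c.periodic s]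
  have habs : Continuous fun s : ℝ => |s - s₀| := by fun_prop
  have hvV : ∀ s, |s - s₀| < 3 * c.L / 4 → v =ᶠ[nhds s] V := fun s hs => by
    filter_upwards [(habs.tendsto s).eventually (gt_mem_nhds hs)] with x hx using hXV x hx.le
  have hv2 : ContDiff ℝ 2 v := by
    rw [contDiff_iff_contDiffAt]
    intro s
    obtain ⟨n, hn, -⟩ := existsUnique_add_zsmul_mem_Ico hL s (s₀ - c.L / 2)
    have hshift : v = fun x => v (x + n • c.L) := funext fun x => (hper.zsmul n x).symm
    have hnear : |s + n • c.L - s₀| < 3 * c.L / 4 := by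
      rw [abs_lt]
      constructor <;> linarith [hn.1, hn.2]
    rw [hshift]
    have h1 : ContDiffAt ℝ 2 v (s + n • c.L) :=
      (contDiff_infty.1 hV 2).contDiffAt.congr_of_eventuallyEq (hvV _ hnear)
    have h2 : ContDiffAt ℝ 2 (fun x : ℝ => x + n • c.L) s :=
      (contDiff_id.add contDiff_const).contDiffAt
    exact ContDiffAt.comp (g := v) s h1 h2
  have hvd : ContDiff ℝ 1 (deriv v) := ((contDiff_succ_iff_deriv (n := 1)).1 hv2).2.2
  have hd1 : ∀ s, HasDerivAt v (deriv v s) s := fun s =>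
    (hv2.differentiable (by simp) s).hasDerivAt
  have hd2 : ∀ s, HasDerivAt (deriv v) (deriv (deriv v) s) s := fun s =>
    (hvd.differentiable (by simp) s).hasDerivAt
  have hzero := integral_variationDensity_eq_zero h𝒜 hmin hXd hXs (fun s => rfl) hd1 hd2
    (hvd.continuous_deriv (by simp))
  have hper1 : Function.Periodic (deriv v) c.L := fun s => by
    rw [← deriv_comp_add_const]
    exact congrArg (fun f => deriv f s) (funext hper)
  have hper2 : Function.Periodic (deriv (deriv v)) c.L := fun s => by
    rw [← deriv_comp_add_const]
    exact congrArg (fun f => deriv f s) (funext hper1)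
  have hperD : Function.Periodic (c.variationDensity v (deriv v) (deriv (deriv v))) c.L :=
    fun s => by
      simp only [variationDensity, c.periodic_curvature s, c.periodic_tangent s, hper s, hper1 s,
        hper2 s]
  set D : ℝ → ℝ := c.variationDensity V (fun s => deriv g s * e)
    (fun s => deriv (deriv g) s * e) with hD
  have hDv : ∀ s, |s - s₀| < 3 * c.L / 4 →
      c.variationDensity v (deriv v) (deriv (deriv v)) s = D s := by
    intro s hs
    have h0 := hvV s hs
    have hdV : deriv V = fun s => ((deriv g s : ℝ) : ℂ) * e := funext fun s => (hV1 s).deriv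
    simp only [hD, variationDensity]
    rw [h0.eq_of_nhds, h0.deriv_eq, h0.deriv.deriv_eq, hdV, (hV2 s).deriv]
  have hD0 : ∀ s, δ ≤ |s - s₀| → D s = 0 := fun s hs => by
    simp only [hD, variationDensity, hVdef, hg.eq_zero hs, hg.deriv.eq_zero hs,
      hg.deriv.deriv.eq_zero hs]
    simp
  have hsupp : Function.support D ⊆ Ioc (s₀ - δ) (s₀ + δ) := by
    intro s hs
    by_contra hs'
    refine hs (hD0 s ?_)
    rw [mem_Ioc, not_and_or, not_lt, not_le] at hs'
    rw [le_abs']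
    rcases hs' with h | h
    · left; linarith
    · right; linarith
  have hshift := hperD.intervalIntegral_add_eq 0 (s₀ - c.L / 2)
  rw [zero_add, hzero] at hshift
  rw [intervalIntegral.integral_eq_integral_of_support_subset hsupp,
    ← intervalIntegral.integral_eq_integral_of_support_subset (a := s₀ - c.L / 2)
      (b := s₀ - c.L / 2 + c.L)
      (hsupp.trans (Ioc_subset_Ioc (by linarith) (by linarith))), hshift]
  refine intervalIntegral.integral_congr fun s hs => (hDv s ?_).symm
  rw [uIcc_of_le (by linarith)] at hs
  rw [abs_lt]
  constructor <;> linarith [hs.1, hs.2]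

theorem hasDerivAt_im_mul_conj_γ (e z : ℂ) (s : ℝ) :
    HasDerivAt (fun s => (e * (starRingEnd ℂ) (c.γ s - z)).im)
      (e * (starRingEnd ℂ) (c.tangent s)).im s := by
  have h1 : HasDerivAt (fun s => (starRingEnd ℂ) (c.γ s - z)) ((starRingEnd ℂ) (c.tangent s)) s :=
    Complex.conjCLE.toContinuousLinearMap.hasFDerivAt.comp_hasDerivAt s
      ((c.hasDerivAt_γ s).sub_const z)
  exact Complex.imCLM.hasFDerivAt.comp_hasDerivAt s (h1.const_mul e)

/-- The density whose primitive is, up to sign and an affine function, the component of `i k τ`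
given by `e`. -/
noncomputable def eulerDensity (s₀ : ℝ) (e : ℂ) (s : ℝ) : ℝ :=
  3 / 2 * (c.curvature s ^ 2 * (e * (starRingEnd ℂ) (c.tangent s)).re) -
    (e * (starRingEnd ℂ) (c.γ s - c.γ s₀)).im

theorem intervalIntegrable_eulerDensity (s₀ : ℝ) (e : ℂ) (a b : ℝ) :
    IntervalIntegrable (c.eulerDensity s₀ e) volume a b := by
  have h1 := Complex.continuous_re.comp (c.continuous_mul_conj_tangent (f := fun _ => e)
    continuous_const)
  have h2 : Continuous fun s => (e * (starRingEnd ℂ) (c.γ s - c.γ s₀)).im :=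
    continuous_iff_continuousAt.2 fun s => (c.hasDerivAt_im_mul_conj_γ e _ s).continuousAt
  exact (((c.intervalIntegrable_curvature_sq a b).mul_continuousOn h1.continuousOn).const_mul
    (3 / 2)).sub (h2.intervalIntegrable a b)

/-- The weak Euler equation, integrated twice by the du Bois-Reymond lemma. -/
theorem exists_ae_curvature_mul_eq {s₀ δ : ℝ} (hδ : 0 < δ) (e : ℂ)
    (h : ∀ g : ℝ → ℝ, IsTestFunction s₀ δ g →
      ∫ s in s₀ - δ..s₀ + δ, c.variationDensity (fun s => g s * e) (fun s => deriv g s * e)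
        (fun s => deriv (deriv g) s * e) s = 0) :
    ∃ A B : ℝ, ∀ᵐ s, s ∈ ball s₀ δ →
      c.curvature s * (e * (starRingEnd ℂ) (c.tangent s)).im =
        A + B * s - ∫ x in s₀..s, c.eulerDensity s₀ e x := by
  set u : ℝ → ℂ := fun s => e * (starRingEnd ℂ) (c.tangent s) with hu
  have huc : Continuous u := c.continuous_mul_conj_tangent continuous_const
  set p : ℝ → ℝ := fun s => (e * (starRingEnd ℂ) (c.γ s - c.γ s₀)).im with hp
  have hpd : ∀ s, HasDerivAt p (u s).im s := c.hasDerivAt_im_mul_conj_γ e _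
  have hpc : Continuous p := continuous_iff_continuousAt.2 fun s => (hpd s).continuousAt
  have hui : Continuous fun s => (u s).im := Complex.continuous_im.comp huc
  have hur : Continuous fun s => (u s).re := Complex.continuous_re.comp huc
  have hpint : ∀ s, ∫ x in s₀..s, (u x).im = p s := fun s => by
    rw [intervalIntegral.integral_eq_sub_of_hasDerivAt (fun x _ => hpd x)
      (hui.intervalIntegrable _ _)]
    simp [hp]
  set G : ℝ → ℝ := fun s => ∫ x in s₀..s, c.eulerDensity s₀ e x
  have iE := c.intervalIntegrable_eulerDensity s₀ e
  have hGc : Continuous G := intervalIntegral.continuous_primitive iE s₀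
  have ik : ∀ a b, IntervalIntegrable (fun s => c.curvature s * (u s).im) volume a b := fun a b =>
    (c.intervalIntegrable_curvature a b).mul_continuousOn hui.continuousOn
  have ik2 : ∀ a b, IntervalIntegrable (fun s => c.curvature s ^ 2 * (u s).re) volume a b :=
    fun a b => (c.intervalIntegrable_curvature_sq a b).mul_continuousOn hur.continuousOn
  have iG : ∀ a b, IntervalIntegrable G volume a b := fun a b => hGc.intervalIntegrable a b
  suffices key : ∃ A B : ℝ, ∀ᵐ s, s ∈ ball s₀ δ → c.curvature s * (u s).im + G s = A + B * s by
    obtain ⟨A, B, hAB⟩ := key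
    refine ⟨A, B, ?_⟩
    filter_upwards [hAB] with s hs hs'
    linarith [hs hs']
  refine ae_eq_affine_of_integral_deriv_deriv_mul_eq_zero hδ
    (fun a b => (ik a b).add (iG a b)) fun g hg => ?_
  have h1 := h g hg
  have h2 := hg.integral_mul_eq_neg (fun a b => hui.intervalIntegrable a b) s₀
  have h3 := hg.deriv.integral_mul_eq_neg iE s₀
  simp_rw [hpint] at h2
  have h4 : ∀ s, c.variationDensity (fun s => g s * e) (fun s => deriv g s * e)
      (fun s => deriv (deriv g) s * e) s = deriv (deriv g) s * (c.curvature s * (u s).im) -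
        3 / 2 * (deriv g s * (c.curvature s ^ 2 * (u s).re)) - g s * (u s).im := by
    intro s
    simp only [variationDensity, hu, mul_assoc, Complex.re_ofReal_mul, Complex.im_ofReal_mul]
    ring
  have h5 : ∀ s, deriv g s * c.eulerDensity s₀ e s =
      3 / 2 * (deriv g s * (c.curvature s ^ 2 * (u s).re)) - deriv g s * p s := by
    intro s
    simp only [eulerDensity, hu, hp]
    ring
  simp_rw [h4] at h1
  simp_rw [h5] at h3
  have i1 := hg.deriv.deriv.intervalIntegrable_mul ik (s₀ - δ) (s₀ + δ)
  have i2 := (hg.deriv.intervalIntegrable_mul ik2 (s₀ - δ) (s₀ + δ)).const_mul (3 / 2)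
  have i3 := hg.intervalIntegrable_mul (fun a b => hui.intervalIntegrable a b) (s₀ - δ) (s₀ + δ)
  have i4 := hg.deriv.intervalIntegrable_mul (fun a b => hpc.intervalIntegrable a b) (s₀ - δ)
    (s₀ + δ)
  rw [intervalIntegral.integral_sub (i1.sub i2) i3, intervalIntegral.integral_sub i1 i2] at h1
  rw [intervalIntegral.integral_sub i2 i4] at h3
  simp_rw [mul_add]
  rw [intervalIntegral.integral_add i1 (hg.deriv.deriv.intervalIntegrable_mul iG _ _)]
  linarith

theorem hasDerivAt_conj_tangent_mul {k : ℝ} {s : ℝ} (h : HasDerivAt c.θ k s) (e : ℂ) :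
    HasDerivAt (fun s => (e * (starRingEnd ℂ) (c.tangent s)).im)
      (-(k * (e * (starRingEnd ℂ) (c.tangent s)).re)) s := by
  have hk : c.curvature s = k := h.deriv
  have h1 := (c.hasDerivAt_conj_tangent (hk ▸ h)).const_mul e
  refine (Complex.imCLM.hasFDerivAt.comp_hasDerivAt s h1).congr_deriv ?_
  rw [hk, Complex.imCLM_apply]
  have : e * -(Complex.I * k * (starRingEnd ℂ) (c.tangent s)) =
      k * (-Complex.I * (e * (starRingEnd ℂ) (c.tangent s))) := by ring
  rw [this, Complex.im_ofReal_mul]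
  simp
  ring

/-- The weak Euler equation forces the curvature to be differentiable. The integrated equation is
that the vector `k' τ + ½ k² ν - γ` is constant. -/
theorem exists_curvature_deriv_eq {s₀ δ : ℝ} (hδ : 0 < δ)
    (h : ∀ (e : ℂ) (g : ℝ → ℝ), IsTestFunction s₀ δ g →
      ∫ s in s₀ - δ..s₀ + δ, c.variationDensity (fun s => g s * e) (fun s => deriv g s * e)
        (fun s => deriv (deriv g) s * e) s = 0) :
    ∃ R : ℂ, ∀ s ∈ ball s₀ δ, HasDerivAt c.θ (c.curvature s) s ∧
      DifferentiableAt ℝ c.curvature s ∧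
      deriv c.curvature s * c.tangent s + (1 / 2) * c.curvature s ^ 2 * c.normal s - c.γ s = R := by
  choose A B hAB using fun e => c.exists_ae_curvature_mul_eq hδ e (h e)
  set u : ℂ → ℝ → ℂ := fun e s => e * (starRingEnd ℂ) (c.tangent s) with hu
  have huc : ∀ e, Continuous (u e) := fun e => c.continuous_mul_conj_tangent continuous_const
  have hui : ∀ e, Continuous fun s => (u e s).im := fun e => Complex.continuous_im.comp (huc e)
  have hur : ∀ e, Continuous fun s => (u e s).re := fun e => Complex.continuous_re.comp (huc e)
  set N : ℂ → ℝ → ℝ := fun e s => A e + B e * s - ∫ x in s₀..s, c.eulerDensity s₀ e x with hN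
  have hNc : ∀ e, Continuous (N e) := fun e =>
    (continuous_const.add (continuous_const.mul continuous_id)).sub
      (intervalIntegral.continuous_primitive (c.intervalIntegrable_eulerDensity s₀ e) s₀)
  -- The two components of the unit vector `τ̄` recover the curvature.
  have hunit : ∀ s, (u 1 s).im ^ 2 + (u Complex.I s).im ^ 2 = 1 := fun s => by
    have h1 := c.norm_tangent s
    rw [← sq_eq_sq₀ (norm_nonneg _) zero_le_one, ← Complex.normSq_eq_norm_sq,
      Complex.normSq_apply] at h1
    simp [hu]
    linarith
  set κ : ℝ → ℝ := fun s => (u 1 s).im * N 1 s + (u Complex.I s).im * N Complex.I s with hκ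
  have hκc : Continuous κ := ((hui 1).mul (hNc 1)).add ((hui Complex.I).mul (hNc Complex.I))
  have hae : ∀ᵐ s, s ∈ ball s₀ δ → c.curvature s = κ s := by
    filter_upwards [hAB 1, hAB Complex.I] with s h1 h2 hs
    have h3 := h1 hs
    have h4 := h2 hs
    simp only [hκ, hN]
    rw [← h3, ← h4]
    linear_combination (-c.curvature s) * hunit s
  have hθ : ∀ s ∈ ball s₀ δ, HasDerivAt c.θ (κ s) s := by
    intro s hs
    have h1 : HasDerivAt (fun s => c.θ s₀ + ∫ x in s₀..s, κ x) (κ s) s :=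
      ((hκc.integral_hasStrictDerivAt s₀ s).hasDerivAt).const_add _
    refine h1.congr_of_eventuallyEq ?_
    filter_upwards [isOpen_ball.mem_nhds hs] with y hy
    have h2 : ∫ x in s₀..y, κ x = ∫ x in s₀..y, c.curvature x := by
      refine intervalIntegral.integral_congr_ae ?_
      filter_upwards [hae] with x hx hx'
      refine (hx ?_).symm
      rw [mem_ball, Real.dist_eq] at hy ⊢
      exact (abs_sub_left_of_mem_uIcc (uIoc_subset_uIcc hx')).trans_lt hy
    rw [h2, ← c.θ_sub_eq]
    ring
  have hkκ : ∀ s ∈ ball s₀ δ, c.curvature s = κ s := fun s hs => (hθ s hs).deriv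
  have hkc : ContinuousOn c.curvature (ball s₀ δ) := hκc.continuousOn.congr hkκ
  have hkN : ∀ e, ∀ s ∈ ball s₀ δ, c.curvature s * (u e s).im = N e s := by
    intro e
    refine Measure.eqOn_open_of_ae_eq (μ := volume) ?_ isOpen_ball
      (hkc.mul (hui e).continuousOn) (hNc e).continuousOn
    rw [Filter.EventuallyEq, ae_restrict_iff' measurableSet_ball]
    exact hAB e
  have hNd : ∀ e, ∀ s ∈ ball s₀ δ, HasDerivAt (N e) (B e - c.eulerDensity s₀ e s) s := by
    intro e s hs
    have hγc : Continuous fun s => (e * (starRingEnd ℂ) (c.γ s - c.γ s₀)).im :=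
      continuous_iff_continuousAt.2 fun s => (c.hasDerivAt_im_mul_conj_γ e _ s).continuousAt
    have hEc : ContinuousOn (c.eulerDensity s₀ e) (ball s₀ δ) :=
      (continuousOn_const.mul ((hkc.pow 2).mul (hur e).continuousOn)).sub hγc.continuousOn
    have hEm : StronglyMeasurableAtFilter (c.eulerDensity s₀ e) (nhds s) :=
      hEc.stronglyMeasurableAtFilter isOpen_ball s hs
    have h1 := intervalIntegral.integral_hasDerivAt_right
      (c.intervalIntegrable_eulerDensity s₀ e s₀ s) hEm (hEc.continuousAt (isOpen_ball.mem_nhds hs))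
    have h2 : HasDerivAt (fun s => A e + B e * s) (B e) s := by
      simpa using ((hasDerivAt_id s).const_mul (B e)).const_add (A e)
    exact h2.sub h1
  have hkd : ∀ s ∈ ball s₀ δ, DifferentiableAt ℝ c.curvature s := by
    intro s hs
    have h1 : ∀ e, DifferentiableAt ℝ (fun s => (u e s).im) s := fun e =>
      (c.hasDerivAt_conj_tangent_mul (hθ s hs) e).differentiableAt
    have h2 : ∀ e, DifferentiableAt ℝ (N e) s := fun e => (hNd e s hs).differentiableAt
    have h3 : DifferentiableAt ℝ κ s :=
      ((h1 1).mul (h2 1)).add ((h1 Complex.I).mul (h2 Complex.I))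
    refine h3.congr_of_eventuallyEq ?_
    filter_upwards [isOpen_ball.mem_nhds hs] with y hy using hkκ y hy
  have hcomp : ∀ e, ∀ s ∈ ball s₀ δ, deriv c.curvature s * (u e s).im +
      1 / 2 * c.curvature s ^ 2 * (u e s).re -
        (e * (starRingEnd ℂ) (c.γ s - c.γ s₀)).im = B e := by
    intro e s hs
    have h1 := (hkd s hs).hasDerivAt.mul (c.hasDerivAt_conj_tangent_mul (hθ s hs) e)
    have h2 := (hNd e s hs).congr_of_eventuallyEq
      (f₁ := fun s => c.curvature s * (u e s).im) (by
        filter_upwards [isOpen_ball.mem_nhds hs] with y hy using hkN e y hy)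
    have h3 := h1.unique h2
    rw [← hkκ s hs] at h3
    simp only [eulerDensity] at h3
    simp only [hu] at h3 ⊢
    linear_combination h3
  refine ⟨B Complex.I - B 1 * Complex.I - c.γ s₀, fun s hs => ⟨?_, hkd s hs, ?_⟩⟩
  · rw [hkκ s hs]
    exact hθ s hs
  have h1 := hcomp 1 s hs
  have h2 := hcomp Complex.I s hs
  simp only [hu] at h1 h2
  apply Complex.ext
  · simp [normal, pow_two] at h2 ⊢
    linarith
  · simp [normal, pow_two] at h1 ⊢
    linarith

end ElasticLoop

/-! ### The optimality conditions on a free branch -/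

namespace ElasticLoop

variable (c : ElasticLoop)

theorem normal_mul_conj_tangent (s : ℝ) :
    c.normal s * (starRingEnd ℂ) (c.tangent s) = -Complex.I := by
  rw [normal, mul_assoc, mul_comm (c.tangent s), conj_tangent_mul, mul_one]

/-- The differential equation of the curvature follows from its first integral. -/
theorem hasDerivAt_deriv_curvature {s₀ δ : ℝ} {R : ℂ} (hδ : 0 < δ)
    (h : ∀ s ∈ ball s₀ δ, HasDerivAt c.θ (c.curvature s) s ∧ DifferentiableAt ℝ c.curvature s ∧
      deriv c.curvature s * c.tangent s + (1 / 2) * c.curvature s ^ 2 * c.normal s - c.γ s = R) :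
    HasDerivAt (deriv c.curvature) (-(1 / 2) * c.curvature s₀ ^ 3 + 1) s₀ := by
  have hprod : ∀ s ∈ ball s₀ δ, (R + c.γ s) * (starRingEnd ℂ) (c.tangent s) =
      deriv c.curvature s - (1 / 2) * c.curvature s ^ 2 * Complex.I := by
    intro s hs
    have h1 := c.conj_tangent_mul s
    have h2 := c.normal_mul_conj_tangent s
    rw [← (h s hs).2.2]
    linear_combination ((deriv c.curvature s : ℝ) : ℂ) * h1 + (1 / 2) * (c.curvature s : ℂ) ^ 2 * h2
  have hs₀ := mem_ball_self (x := s₀) hδ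
  have h1 : HasDerivAt (fun s => ((R + c.γ s) * (starRingEnd ℂ) (c.tangent s)).re)
      (-(1 / 2) * c.curvature s₀ ^ 3 + 1) s₀ := by
    have h2 := ((c.hasDerivAt_γ s₀).const_add R).mul (c.hasDerivAt_conj_tangent (h s₀ hs₀).1)
    refine (Complex.reCLM.hasFDerivAt.comp_hasDerivAt s₀ h2).congr_deriv ?_
    have h3 : c.tangent s₀ * (starRingEnd ℂ) (c.tangent s₀) +
        (R + c.γ s₀) * -(Complex.I * c.curvature s₀ * (starRingEnd ℂ) (c.tangent s₀)) =
        ((-(1 / 2) * c.curvature s₀ ^ 3 + 1 : ℝ) : ℂ) -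
          (c.curvature s₀ * deriv c.curvature s₀ : ℝ) * Complex.I := by
      have h4 := c.conj_tangent_mul s₀
      have h5 := hprod s₀ hs₀
      push_cast
      linear_combination h4 - Complex.I * c.curvature s₀ * h5 +
        (1 / 2) * (c.curvature s₀ : ℂ) ^ 3 * Complex.I_sq
    rw [Complex.reCLM_apply, h3, Complex.sub_re, Complex.ofReal_re, Complex.re_ofReal_mul,
      Complex.I_re, mul_zero, sub_zero]
  refine h1.congr_of_eventuallyEq ?_
  filter_upwards [isOpen_ball.mem_nhds hs₀] with s hs
  rw [hprod s hs]
  simp [pow_two]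

/-- Smoothness of the solutions of `k'' = -½ k³ + 1`, by induction on the order. -/
theorem contDiffOn_infty_of_hasDerivAt_deriv {k : ℝ → ℝ} {U : Set ℝ} (hU : IsOpen U)
    (hk : ∀ s ∈ U, DifferentiableAt ℝ k s)
    (hk' : ∀ s ∈ U, HasDerivAt (deriv k) (-(1 / 2) * k s ^ 3 + 1) s) : ContDiffOn ℝ ∞ k U := by
  have hd : DifferentiableOn ℝ k U := fun s hs => (hk s hs).differentiableWithinAt
  have hd' : DifferentiableOn ℝ (deriv k) U := fun s hs =>
    (hk' s hs).differentiableAt.differentiableWithinAt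
  have key : ∀ n : ℕ, ContDiffOn ℝ n k U ∧ ContDiffOn ℝ n (deriv k) U := by
    intro n
    induction n with
    | zero => simpa using ⟨hd.continuousOn, hd'.continuousOn⟩
    | succ n ih =>
      push_cast
      rw [contDiffOn_succ_iff_deriv_of_isOpen hU, contDiffOn_succ_iff_deriv_of_isOpen hU]
      refine ⟨⟨hd, by simp, ih.2⟩, hd', by simp, ?_⟩
      exact ((contDiffOn_const.mul (ih.1.pow 3)).add contDiffOn_const).congr fun s hs =>
        (hk' s hs).deriv
  exact contDiffOn_infty.2 fun n => (key n).1

theorem norm_sq_add_mul_normal (x y : ℝ) (s : ℝ) :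
    ‖(x : ℂ) * c.tangent s + y * c.normal s‖ ^ 2 = x ^ 2 + y ^ 2 := by
  have h1 : (x : ℂ) * c.tangent s + y * c.normal s = (x - y * Complex.I) * c.tangent s := by
    rw [normal]
    ring
  rw [h1, norm_mul, norm_tangent, mul_one, ← Complex.normSq_eq_norm_sq, Complex.normSq_apply]
  simp
  ring

end ElasticLoop

theorem mainTheorem4
    (𝒜 : Set ℂ → ElasticLoop → Prop) (h𝒜 : 𝒜 = IsJordanDomain ∨ 𝒜 = IsLoopDomain)
    (Ω : Set ℂ) (c : ElasticLoop) (hmin : IsEnergyMinimizer 𝒜 Ω c)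
    (a b : ℝ) (hbranch : c.IsFreeBranch a b) :
    ContDiffOn ℝ ∞ c.curvature (Ioo a b) ∧
    (∀ s ∈ Ioo a b, deriv (deriv c.curvature) s = -(1 / 2) * c.curvature s ^ 3 + 1) ∧
    ∃ (C : ℝ) (Q : ℂ), ∀ s ∈ Ioo a b,
      deriv c.curvature s ^ 2 = -(1 / 4) * c.curvature s ^ 4 + 2 * c.curvature s + 2 * C ∧
      dist Q (c.γ s) ^ 2 = 2 * c.curvature s + 2 * C ∧
      inner ℝ (c.γ s - Q) (c.normal s) = (1 / 2) * c.curvature s ^ 2 := by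
  have hlocal : ∀ s₀ ∈ Ioo a b, ∃ δ > 0, ∃ R : ℂ, ∀ s ∈ ball s₀ δ,
      HasDerivAt c.θ (c.curvature s) s ∧ DifferentiableAt ℝ c.curvature s ∧
      deriv c.curvature s * c.tangent s + (1 / 2) * c.curvature s ^ 2 * c.normal s - c.γ s = R := by
    intro s₀ hs₀
    obtain ⟨δ, hδ, h⟩ := ElasticLoop.exists_integral_variationDensity_isTestFunction h𝒜 hmin
      (hbranch.2 s₀ hs₀)
    exact ⟨δ, hδ, c.exists_curvature_deriv_eq hδ h⟩
  have hk : ∀ s ∈ Ioo a b, DifferentiableAt ℝ c.curvature s := fun s hs => by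
    obtain ⟨δ, hδ, R, h⟩ := hlocal s hs
    exact (h s (mem_ball_self hδ)).2.1
  have hk' : ∀ s ∈ Ioo a b,
      HasDerivAt (deriv c.curvature) (-(1 / 2) * c.curvature s ^ 3 + 1) s := fun s hs => by
    obtain ⟨δ, hδ, R, h⟩ := hlocal s hs
    exact c.hasDerivAt_deriv_curvature hδ h
  refine ⟨ElasticLoop.contDiffOn_infty_of_hasDerivAt_deriv isOpen_Ioo hk hk',
    fun s hs => (hk' s hs).deriv, ?_⟩
  -- The vector `k' τ + ½ k² ν - γ` is locally constant, hence constant; it is `-Q`.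
  set r : ℝ → ℂ := fun s => deriv c.curvature s * c.tangent s +
    (1 / 2) * c.curvature s ^ 2 * c.normal s - c.γ s with hr
  have hrd : ∀ s ∈ Ioo a b, HasDerivAt r 0 s := by
    intro s₀ hs₀
    obtain ⟨δ, hδ, R, h⟩ := hlocal s₀ hs₀
    refine (hasDerivAt_const s₀ R).congr_of_eventuallyEq ?_
    filter_upwards [isOpen_ball.mem_nhds (mem_ball_self (x := s₀) hδ)] with s hs using (h s hs).2.2
  obtain ⟨R, hR⟩ := isOpen_Ioo.exists_is_const_of_deriv_eq_zero isPreconnected_Ioo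
    (fun s hs => (hrd s hs).differentiableAt.differentiableWithinAt) fun s hs => (hrd s hs).deriv
  set f : ℝ → ℝ := fun s => 1 / 2 * (deriv c.curvature s ^ 2 + 1 / 4 * c.curvature s ^ 4 -
    2 * c.curvature s) with hf
  have hfd : ∀ s ∈ Ioo a b, HasDerivAt f 0 s := by
    intro s hs
    have h0 := (hk s hs).hasDerivAt
    have h1 := ((((hk' s hs).pow 2).add ((h0.pow 4).const_mul (1 / 4))).sub
      (h0.const_mul 2)).const_mul (1 / 2)
    refine h1.congr_deriv ?_
    push_cast
    ring
  obtain ⟨C, hC⟩ := isOpen_Ioo.exists_is_const_of_deriv_eq_zero isPreconnected_Ioo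
    (fun s hs => (hfd s hs).differentiableAt.differentiableWithinAt) fun s hs => (hfd s hs).deriv
  refine ⟨C, -R, fun s hs => ?_⟩
  have hC' : deriv c.curvature s ^ 2 =
      -(1 / 4) * c.curvature s ^ 4 + 2 * c.curvature s + 2 * C := by
    rw [← hC s hs, hf]
    ring
  have hR' : c.γ s - -R = ((deriv c.curvature s : ℝ) : ℂ) * c.tangent s +
      ((1 / 2 * c.curvature s ^ 2 : ℝ) : ℂ) * c.normal s := by
    rw [← hR s hs, hr]
    push_cast
    ring
  refine ⟨hC', ?_, ?_⟩
  · rw [dist_comm, dist_eq_norm, hR', c.norm_sq_add_mul_normal, hC']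
    ring
  · rw [c.inner_normal, hR']
    have h1 : (((deriv c.curvature s : ℝ) : ℂ) * c.tangent s +
        ((1 / 2 * c.curvature s ^ 2 : ℝ) : ℂ) * c.normal s) * (starRingEnd ℂ) (c.tangent s) =
        ((deriv c.curvature s : ℝ) : ℂ) - ((1 / 2 * c.curvature s ^ 2 : ℝ) : ℂ) * Complex.I := by
      have h2 := c.conj_tangent_mul s
      have h3 := c.normal_mul_conj_tangent s
      linear_combination ((deriv c.curvature s : ℝ) : ℂ) * h2 +
        ((1 / 2 * c.curvature s ^ 2 : ℝ) : ℂ) * h3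
    rw [h1, Complex.sub_im, Complex.ofReal_im, Complex.im_ofReal_mul, Complex.I_im]
    ring
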